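/- Let $G$ be a finite simple graph, $C=\{c_1,\dots,c_k\}$ a set of colors and $c\colon V(G)\to C$ a coloring of the vertices. Two vertices $u,v$ are weakly $c_i$-avoiding connected if, after the removal of all vertices of color $c_i$, at least one of $u,v$ is deleted or $u$ and $v$ lie in the same component of the remaining graph. They are weakly color-avoiding connected if they are in the same component of $G$ and are weakly $c_i$-avoiding connected for every $i\in\{1,\dots,k\}$. A weakly color-avoiding connected component of $G$ is an inclusion-maximal set of vertices any two of which are weakly color-avoiding connected. The decision problem WeaklyColorAvoidingConnectedComponent (given $G$, $C$, $c$ and a positive integer $l$, does $G$ have a weakly color-avoiding connected component of size at least $l$?) is in P. More precisely, there is a polynomial-time algorithm that, given $G$, $C$ and $c$, lists all weakly color-avoiding connected components of $G$. Both assertions remain true when every vertex $v$ is assigned a set $c(v)\subseteq C$ of colors and is removed by the attack on $c_i$ only if $c(v)=\{c_i\}$, so that vertices with at least two different colors are indestructible. -/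

import Mathlib

namespace ColorAvoiding

/-! ### Weak color-avoiding connectivity -/

section Connectivity

variable {V C : Type*}

/-- `killed v i` says that the vertex `v` is destroyed when the color `i` is attacked.
Two vertices are weakly `i`-avoiding connected if, after the removal of all vertices that are
destroyed by `i`, at least one of them is deleted or they lie in the same component of the
remaining graph. -/
def WeaklyAvoidingConnected (G : SimpleGraph V) (killed : V → C → Prop) (i : C) (u v : V) : Prop :=
  ∀ (hu : ¬ killed u i) (hv : ¬ killed v i),
    (G.induce {w : V | ¬ killed w i}).Reachable ⟨u, hu⟩ ⟨v, hv⟩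

/-- Weak color-avoiding connectivity: weakly `i`-avoiding connected for every color `i`, and, as `G`
need not be connected, in the same component of `G` (which is automatic for connected `G`). -/
def WeaklyConnected (G : SimpleGraph V) (killed : V → C → Prop) (u v : V) : Prop :=
  G.Reachable u v ∧ ∀ i : C, WeaklyAvoidingConnected G killed i u v

/-- Weakly color-avoiding connected components: the inclusion-maximal sets of vertices any two
elements of which are weakly color-avoiding connected. -/
def IsWeakComponent (G : SimpleGraph V) (killed : V → C → Prop) (S : Finset V) : Prop :=
  Maximal (fun T : Finset V => ∀ u ∈ T, ∀ v ∈ T, WeaklyConnected G killed u v) S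

end Connectivity

/-! ### Vertex-colored graphs -/

/-- A finite graph on the vertices `0, …, n - 1` with color set `{0, …, k - 1}` and exactly one color
on every vertex. -/
structure ColoredGraph where
  /-- the number of vertices -/
  n : ℕ
  /-- the number of colors -/
  k : ℕ
  /-- the graph -/
  graph : SimpleGraph (Fin n)
  /-- the coloring -/
  color : Fin n → Fin k

/-- A finite graph on the vertices `0, …, n - 1` with color set `{0, …, k - 1}` and a set of colors
on every vertex. -/
structure MulticoloredGraph where
  /-- the number of vertices -/
  n : ℕ
  /-- the number of colors -/
  k : ℕ
  /-- the graph -/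
  graph : SimpleGraph (Fin n)
  /-- the colors of a vertex -/
  colors : Fin n → Finset (Fin k)

/-- A vertex with a single color is destroyed by the attack on that color. -/
def ColoredGraph.Killed (I : ColoredGraph) (v : Fin I.n) (i : Fin I.k) : Prop :=
  I.color v = i

/-- The attack on color `i` destroys precisely the vertices whose only color is `i`: a vertex with at
least two different colors is indestructible. -/
def MulticoloredGraph.Killed (I : MulticoloredGraph) (v : Fin I.n) (i : Fin I.k) : Prop :=
  I.colors v = {i}

/-- The weakly color-avoiding connected components of a vertex-colored graph. -/
def ColoredGraph.IsComponent (I : ColoredGraph) (S : Finset (Fin I.n)) : Prop :=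
  IsWeakComponent I.graph I.Killed S

/-- The weakly color-avoiding connected components of a multicolored graph. -/
def MulticoloredGraph.IsComponent (I : MulticoloredGraph) (S : Finset (Fin I.n)) : Prop :=
  IsWeakComponent I.graph I.Killed S

/-! ### Encodings -/

/-- The tape alphabet of inputs and outputs: the two bits and a separator `none`. -/
abbrev Symbol : Type := Option Bool

/-- A list of bit strings as one word: every bit string is followed by a separator. -/
def encodeLists (L : List (List Bool)) : List Symbol :=
  L.flatMap fun r => r.map some ++ [none]

open Classical in
/-- The characteristic vector of a subset of `{0, …, m - 1}`. -/
noncomputable def charVector {m : ℕ} (S : Finset (Fin m)) : List Bool :=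
  List.ofFn fun j => decide (j ∈ S)

open Classical in
/-- The rows of the adjacency matrix. -/
noncomputable def adjacencyRows {n : ℕ} (G : SimpleGraph (Fin n)) : List (List Bool) :=
  List.ofFn fun u => List.ofFn fun v => decide (G.Adj u v)

/-- The data of a vertex-colored graph: `n` and `k` in unary, the adjacency matrix, and for every
vertex the characteristic vector (of length `k`) of its color. -/
noncomputable def ColoredGraph.rows (I : ColoredGraph) : List (List Bool) :=
  [List.replicate I.n true, List.replicate I.k true] ++ adjacencyRows I.graph ++
    List.ofFn fun v => charVector {I.color v}

/-- The data of a multicolored graph: `n` and `k` in unary, the adjacency matrix, and for every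
vertex the characteristic vector (of length `k`) of its set of colors. -/
noncomputable def MulticoloredGraph.rows (I : MulticoloredGraph) : List (List Bool) :=
  [List.replicate I.n true, List.replicate I.k true] ++ adjacencyRows I.graph ++
    List.ofFn fun v => charVector (I.colors v)

/-- The word that encodes a vertex-colored graph. -/
noncomputable def ColoredGraph.encode (I : ColoredGraph) : List Symbol :=
  encodeLists I.rows

/-- The word that encodes a multicolored graph. -/
noncomputable def MulticoloredGraph.encode (I : MulticoloredGraph) : List Symbol :=
  encodeLists I.rows

/-- The word that encodes a vertex-colored graph together with a number `l`, given in binary. -/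
noncomputable def ColoredGraph.encodeWith (I : ColoredGraph) (l : ℕ) : List Symbol :=
  encodeLists (l.bits :: I.rows)

/-- The word that encodes a multicolored graph together with a number `l`, given in binary. -/
noncomputable def MulticoloredGraph.encodeWith (I : MulticoloredGraph) (l : ℕ) : List Symbol :=
  encodeLists (l.bits :: I.rows)

/-! ### Polynomial time -/

open Classical in
/-- The complexity class P: some Turing machine decides, in time polynomial in the length of the
word, for every word over the alphabet whether it belongs to the language. -/
def InP {Γ : Type} (L : Language Γ) : Prop :=
  Nonempty (Turing.TM2ComputableInPolyTime (fun w : List Γ => w) Computability.encodeBool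
    (fun w : List Γ => decide (w ∈ L)))

/-- For every instance `a` let `sol a` be a collection of subsets of `{0, …, n a - 1}`. This
collection can be found in polynomial time: some Turing machine, given the encoding of `a`, writes
in time polynomial in the length of this encoding a list (of characteristic vectors) that contains
every member of `sol a` exactly once and nothing else. -/
def FindableInPolyTime {α : Type} (enc : α → List Symbol) (n : α → ℕ)
    (sol : (a : α) → Set (Finset (Fin (n a)))) : Prop :=
  ∃ f : (a : α) → List (Finset (Fin (n a))),
    (∀ a, (f a).Nodup ∧ ∀ S, S ∈ f a ↔ S ∈ sol a) ∧
    Nonempty (Turing.TM2ComputableInPolyTime enc encodeLists fun a => (f a).map charVector)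

/-- The decision problem: given a graph, a set of colors, one color for each vertex and a positive
integer `l`, is there a weakly color-avoiding connected component of size at least `l`? -/
def weaklyColorAvoidingConnectedComponent : Language Symbol :=
  {w | ∃ (I : ColoredGraph) (l : ℕ), 0 < l ∧ w = I.encodeWith l ∧
    ∃ S, I.IsComponent S ∧ l ≤ S.card}

/-- The same decision problem for graphs whose vertices may have several colors, which makes them
indestructible. -/
def weaklyColorAvoidingConnectedComponentMulti : Language Symbol :=
  {w | ∃ (I : MulticoloredGraph) (l : ℕ), 0 < l ∧ w = I.encodeWith l ∧
    ∃ S, I.IsComponent S ∧ l ≤ S.card}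

end ColorAvoiding

/-! Weak color-avoiding connectivity is reflexive and symmetric, but not transitive: a chain `u`,
`v`, `w` breaks at a color that destroys `v` and neither `u` nor `w`. The components are the maximal
cliques of this relation, and in a general graph maximal cliques are numerous. Here every vertex is
destroyed by at most one color, which leaves at most `n ^ 2` of them. Let `S` be a nonempty
component. If two members `u`, `v` (possibly equal) are never destroyed together, then any two
common neighbors of `u` and `v` are linked through `u`, or through `v` when `u` is destroyed; so the
common neighborhood is a clique and equals `S`. Otherwise one color destroys all of `S`, and a
neighbor of one member is a neighbor of all, because whenever the linking member is lost the other
members are lost too; so `S` is the neighborhood of any of its members. Conversely, a clique that is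
the common neighborhood of two adjacent (or equal) vertices contains both and is therefore maximal.
This is `isWeakComponent_iff`.

The algorithm tests every pair `u`, `v`, computing reachability after each attack by `n` rounds of
adding neighbors. A colored graph is the multicolored graph whose color sets are singletons, so one
algorithm serves both models.

Polynomial time refers to actual stack machines. Structured programs are compiled to machines with
exact step counts (`Exec.compile`). Data are binary trees, written in preorder on one stack, and `PT
f` says that some program replaces the topmost tree by its image within polynomial time and size,
leaving what lies below intact. This class is closed under composition, pairing, case distinction
and iteration with polynomially bounded intermediate sizes (`PT.iterate`, `PT.foldl`). The list
operations follow, and `fun_prop` then derives the running time of the algorithm from its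
definition. -/

open Turing

namespace ColorAvoiding

/-! ### Structured programs for stack machines -/

/-- The names of the stacks: one stack of symbols and four stacks of bits. -/
inductive StackName
  | io | main | left | right | count
  deriving DecidableEq

instance : Fintype StackName where
  elems := {.io, .main, .left, .right, .count}
  complete k := by cases k <;> decide

/-- The names of the stacks of bits. -/
inductive Work
  | main | left | right | count

/-- The alphabets of the stacks. -/
abbrev StackName.Alphabet : StackName → Type
  | .io => Symbol
  | _ => Bool

/-- The internal state of the machines: the symbol that was read last, if any. -/
abbrev Reg : Type := Option Symbol

/-- The memory of the machines. -/
structure Store where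
  /-- the symbol that was read last -/
  reg : Reg
  /-- the stack of symbols -/
  io : List Symbol
  /-- the main stack -/
  main : List Bool
  /-- an auxiliary stack -/
  left : List Bool
  /-- an auxiliary stack -/
  right : List Bool
  /-- a stack that serves as a counter -/
  count : List Bool

namespace Store

/-- The stacks of a store as a family. -/
def stk (s : Store) : ∀ k : StackName, List k.Alphabet
  | .io => s.io
  | .main => s.main
  | .left => s.left
  | .right => s.right
  | .count => s.count

/-- The content of a bit stack. -/
def get (s : Store) : Work → List Bool
  | .main => s.main
  | .left => s.left
  | .right => s.right
  | .count => s.count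

/-- Replace the content of a bit stack. -/
def set (s : Store) : Work → List Bool → Store
  | .main, l => { s with main := l }
  | .left, l => { s with left := l }
  | .right, l => { s with right := l }
  | .count, l => { s with count := l }

end Store

/-- The basic operations. -/
inductive Op
  | clear
  | popSym
  | pushSym (a : Symbol)
  | pop (k : Work)
  | peek (k : Work)
  | pushReg (k : Work)
  | push (k : Work) (l : List Bool)

/-- The bit in the register. -/
def Reg.bit (v : Reg) : Bool := v == some (some true)

/-- The effect of a basic operation. -/
def Op.run : Op → Store → Store
  | .clear, s => { s with reg := none }
  | .popSym, s => { s with reg := s.io.head?, io := s.io.tail }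
  | .pushSym a, s => { s with io := a :: s.io }
  | .pop k, s => { s.set k (s.get k).tail with reg := (s.get k).head?.map some }
  | .peek k, s => { s with reg := (s.get k).head?.map some }
  | .pushReg k, s => s.set k (s.reg.bit :: s.get k)
  | .push k l, s => s.set k (l ++ s.get k)

/-- The statements of the machines. -/
abbrev MStmt (Λ : Type) : Type := TM2.Stmt StackName.Alphabet Λ Reg

/-- Push a list of bits, the last one first. -/
def pushBits {Λ : Type} : Work → List Bool → MStmt Λ → MStmt Λ
  | _, [], q => q
  | .main, b :: l, q => pushBits .main l (.push StackName.main (fun _ => b) q)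
  | .left, b :: l, q => pushBits .left l (.push StackName.left (fun _ => b) q)
  | .right, b :: l, q => pushBits .right l (.push StackName.right (fun _ => b) q)
  | .count, b :: l, q => pushBits .count l (.push StackName.count (fun _ => b) q)

/-- The statement that performs a basic operation and goes on with another statement. -/
def Op.stmt {Λ : Type} : Op → MStmt Λ → MStmt Λ
  | .clear, q => .load (fun _ => none) q
  | .popSym, q => .pop StackName.io (fun _ a => a) q
  | .pushSym a, q => .push StackName.io (fun _ => a) q
  | .pop .main, q => .pop StackName.main (fun _ a => a.map some) q
  | .pop .left, q => .pop StackName.left (fun _ a => a.map some) q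
  | .pop .right, q => .pop StackName.right (fun _ a => a.map some) q
  | .pop .count, q => .pop StackName.count (fun _ a => a.map some) q
  | .peek .main, q => .peek StackName.main (fun _ a => a.map some) q
  | .peek .left, q => .peek StackName.left (fun _ a => a.map some) q
  | .peek .right, q => .peek StackName.right (fun _ a => a.map some) q
  | .peek .count, q => .peek StackName.count (fun _ a => a.map some) q
  | .pushReg .main, q => .push StackName.main Reg.bit q
  | .pushReg .left, q => .push StackName.left Reg.bit q
  | .pushReg .right, q => .push StackName.right Reg.bit q
  | .pushReg .count, q => .push StackName.count Reg.bit q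
  | .push k l, q => pushBits k l q

theorem Store.stk_set (s : Store) :
    (∀ l, Function.update s.stk .io l = Store.stk { s with io := l }) ∧
    (∀ l, Function.update s.stk .main l = Store.stk { s with main := l }) ∧
    (∀ l, Function.update s.stk .left l = Store.stk { s with left := l }) ∧
    (∀ l, Function.update s.stk .right l = Store.stk { s with right := l }) ∧
    (∀ l, Function.update s.stk .count l = Store.stk { s with count := l }) := by
  refine ⟨?_, ?_, ?_, ?_, ?_⟩ <;> intro l <;> funext k <;> cases k <;> rfl

theorem stepAux_pushBits {Λ : Type} (k : Work) (l : List Bool) (q : MStmt Λ) (s : Store) :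
    TM2.stepAux (pushBits k l q) s.reg s.stk = TM2.stepAux q s.reg (s.set k (l ++ s.get k)).stk := by
  induction l generalizing q with
  | nil => cases k <;> rfl
  | cons b l ih =>
    obtain ⟨-, h₁, h₂, h₃, h₄⟩ := Store.stk_set (s.set k (l ++ s.get k))
    cases k <;> simp only [pushBits, ih, TM2.stepAux, h₁, h₂, h₃, h₄] <;> rfl

theorem stepAux_stmt {Λ : Type} (o : Op) (q : MStmt Λ) (s : Store) :
    TM2.stepAux (o.stmt q) s.reg s.stk = TM2.stepAux q (o.run s).reg (o.run s).stk := by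
  obtain ⟨h₀, h₁, h₂, h₃, h₄⟩ := Store.stk_set s
  cases o with
  | clear => rfl
  | popSym => simp only [Op.stmt, TM2.stepAux, h₀]; rfl
  | pushSym a => simp only [Op.stmt, TM2.stepAux, h₀]; rfl
  | pop k => cases k <;> simp only [Op.stmt, TM2.stepAux, h₁, h₂, h₃, h₄] <;> rfl
  | peek k => cases k <;> rfl
  | pushReg k => cases k <;> simp only [Op.stmt, TM2.stepAux, h₁, h₂, h₃, h₄] <;> rfl
  | push k l =>
    simp only [Op.stmt, stepAux_pushBits]
    cases k <;> rfl

/-- Structured programs. -/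
inductive Prog
  | op (o : Op)
  | seq (p q : Prog)
  | ite (c : Reg → Bool) (p q : Prog)
  | loop (c : Reg → Bool) (p : Prog)

/-- `Exec p s s' t`: the program `p`, started with the store `s`, stops with the store `s'` after
`t` steps. -/
inductive Exec : Prog → Store → Store → ℕ → Prop
  | op (o s) : Exec (.op o) s (o.run s) 1
  | seq {p q s s' s'' t t'} : Exec p s s' t → Exec q s' s'' t' → Exec (.seq p q) s s'' (t + t')
  | ite_true {c p q s s' t} : c s.reg = true → Exec p s s' t → Exec (.ite c p q) s s' (t + 1)
  | ite_false {c p q s s' t} : c s.reg = false → Exec q s s' t → Exec (.ite c p q) s s' (t + 1)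
  | loop_halt {c p s} : c s.reg = false → Exec (.loop c p) s s 1
  | loop_step {c p s s' s'' t t'} : c s.reg = true → Exec p s s' t → Exec (.loop c p) s' s'' t' →
      Exec (.loop c p) s s'' (t + t' + 1)

namespace Prog

/-- The labels of the compiled program. -/
def Label : Prog → Type
  | op _ => Unit
  | seq p q => p.Label ⊕ q.Label
  | ite _ p q => Unit ⊕ (p.Label ⊕ q.Label)
  | loop _ p => Unit ⊕ p.Label

/-- A program has finitely many labels. -/
@[reducible]
def labelFintype : ∀ p : Prog, Fintype p.Label
  | op _ => inferInstanceAs (Fintype Unit)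
  | seq p q =>
    have := p.labelFintype
    have := q.labelFintype
    inferInstanceAs (Fintype (p.Label ⊕ q.Label))
  | ite _ p q =>
    have := p.labelFintype
    have := q.labelFintype
    inferInstanceAs (Fintype (Unit ⊕ (p.Label ⊕ q.Label)))
  | loop _ p =>
    have := p.labelFintype
    inferInstanceAs (Fintype (Unit ⊕ p.Label))

/-- The first label of the compiled program. -/
def entry : ∀ p : Prog, p.Label
  | op _ => ()
  | seq p _ => .inl p.entry
  | ite _ _ _ => .inl ()
  | loop _ _ => .inl ()

/-- The compiled program, with its labels embedded by `e`, that jumps to `exit` at its end. -/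
def compile {Λ : Type} : ∀ (p : Prog) (_ : p.Label → Λ) (_ : Λ), p.Label → MStmt Λ
  | op o, _, exit, _ => o.stmt (.goto fun _ => exit)
  | seq p q, e, _, .inl l => p.compile (fun l => e (.inl l)) (e (.inr q.entry)) l
  | seq _ q, e, exit, .inr l => q.compile (fun l => e (.inr l)) exit l
  | ite c p q, e, _, .inl _ =>
    .branch c (.goto fun _ => e (.inr (.inl p.entry))) (.goto fun _ => e (.inr (.inr q.entry)))
  | ite _ p _, e, exit, .inr (.inl l) => p.compile (fun l => e (.inr (.inl l))) exit l
  | ite _ _ q, e, exit, .inr (.inr l) => q.compile (fun l => e (.inr (.inr l))) exit l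
  | loop c p, e, exit, .inl _ =>
    .branch c (.goto fun _ => e (.inr p.entry)) (.goto fun _ => exit)
  | loop _ p, e, _, .inr l => p.compile (fun l => e (.inr l)) (e (.inl ())) l

end Prog

/-! ### Correctness of the compiler, and the resulting Turing machines. -/

/-- The configuration with a given label and store. -/
def Store.cfg {Λ : Type} (s : Store) (l : Option Λ) : TM2.Cfg StackName.Alphabet Λ Reg :=
  ⟨l, s.reg, s.stk⟩

/-- The machine `M`, the embedding `e` and the label `exit` are arbitrary because the induction
descends to subprograms, whose code sits inside the code of the whole and exits to a label of the
surrounding program. -/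
theorem Exec.compile {Λ : Type} (M : Λ → MStmt Λ) {p : Prog} {s s' : Store} {t : ℕ}
    (h : Exec p s s' t) :
    ∀ (e : p.Label → Λ) (exit : Λ), (∀ l, M (e l) = p.compile e exit l) →
      (flip bind (TM2.step M))^[t] (some (s.cfg (some (e p.entry)))) =
        some (s'.cfg (some exit)) := by
  induction h with
  | op o s =>
    intro e exit h
    have hM : M (e (Prog.op o).entry) = o.stmt (.goto fun _ => exit) := h _
    change some (TM2.stepAux (M (e (Prog.op o).entry)) s.reg s.stk) = _
    rw [hM, stepAux_stmt]
    rfl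
  | @seq p q s s' s'' t t' _ _ ih₁ ih₂ =>
    intro e exit h
    rw [add_comm, Function.iterate_add_apply]
    have h₁ := ih₁ (fun l => e (.inl l)) (e (.inr q.entry)) fun l => h (.inl l)
    have h₂ := ih₂ (fun l => e (.inr l)) exit fun l => h (.inr l)
    rw [← h₂]
    exact congrArg _ h₁
  | @ite_true c p q s s' t hc _ ih =>
    intro e exit h
    rw [Function.iterate_add_apply]
    rw [← ih (fun l => e (.inr (.inl l))) exit fun l => h (.inr (.inl l))]
    congr 1
    have hM : M (e (Prog.ite c p q).entry) =
        .branch c (.goto fun _ => e (.inr (.inl p.entry)))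
        (.goto fun _ => e (.inr (.inr q.entry))) := h _
    change some (TM2.stepAux (M (e (Prog.ite c p q).entry)) s.reg s.stk) = _
    rw [hM]
    simp only [TM2.stepAux, hc]
    rfl
  | @ite_false c p q s s' t hc _ ih =>
    intro e exit h
    rw [Function.iterate_add_apply]
    rw [← ih (fun l => e (.inr (.inr l))) exit fun l => h (.inr (.inr l))]
    congr 1
    have hM : M (e (Prog.ite c p q).entry) =
        .branch c (.goto fun _ => e (.inr (.inl p.entry)))
        (.goto fun _ => e (.inr (.inr q.entry))) := h _
    change some (TM2.stepAux (M (e (Prog.ite c p q).entry)) s.reg s.stk) = _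
    rw [hM]
    simp only [TM2.stepAux, hc]
    rfl
  | @loop_halt c p s hc =>
    intro e exit h
    have hM : M (e (Prog.loop c p).entry) =
        .branch c (.goto fun _ => e (.inr p.entry)) (.goto fun _ => exit) := h _
    change some (TM2.stepAux (M (e (Prog.loop c p).entry)) s.reg s.stk) = _
    rw [hM]
    simp only [TM2.stepAux, hc]
    rfl
  | @loop_step c p s s' s'' t t' hc _ _ ih₁ ih₂ =>
    intro e exit h
    rw [Function.iterate_add_apply, add_comm t, Function.iterate_add_apply]
    rw [← ih₂ e exit h]
    congr 1
    -- The body of the loop exits to the label of the loop test.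
    have h₁ := ih₁ (fun l => e (.inr l)) (e (.inl ())) fun l => h (.inr l)
    refine Eq.trans ?_ h₁
    congr 1
    have hM : M (e (Prog.loop c p).entry) =
        .branch c (.goto fun _ => e (.inr p.entry)) (.goto fun _ => exit) := h _
    change some (TM2.stepAux (M (e (Prog.loop c p).entry)) s.reg s.stk) = _
    rw [hM]
    simp only [TM2.stepAux, hc]
    rfl

/-- The machine that runs a program, reads its input on the stack of symbols and returns its output
on the stack `k`. -/
def Prog.machine (p : Prog) (k : StackName) : FinTM2 where
  K := StackName
  k₀ := .io
  k₁ := k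
  Γ := StackName.Alphabet
  Λ := Option p.Label
  main := some p.entry
  ΛFin :=
    have := p.labelFintype
    inferInstanceAs (Fintype (Option p.Label))
  σ := Reg
  initialState := none
  Γk₀Fin := inferInstanceAs (Fintype (Option Bool))
  m
    | some l => p.compile some none l
    | none => .halt

/-- The store with empty stacks. -/
def Store.empty : Store := ⟨none, [], [], [], [], []⟩

/-- The additional step executes the halting statement at the exit label `none`. -/
theorem Exec.evalsTo {p : Prog} (k : StackName) {s s' : Store} {t : ℕ} (h : Exec p s s' t) :
    (flip bind (p.machine k).step)^[t + 1] (some (s.cfg (some (some p.entry)))) =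
      some (s'.cfg none) := by
  rw [add_comm, Function.iterate_add_apply]
  have h' := h.compile (p.machine k).m some none fun l => rfl
  rw [show (p.machine k).step = TM2.step (p.machine k).m from rfl]
  refine Eq.trans (congrArg _ h') ?_
  rfl

theorem initList_machine (p : Prog) (k : StackName) (w : List Symbol) :
    initList (p.machine k) (List.map id w) = { Store.empty with io := w }.cfg (some (some p.entry)) := by
  refine congrArg (TM2.Cfg.mk _ _) ?_
  funext k
  cases k <;> first | rfl | exact List.map_id w

theorem haltList_machine_io (p : Prog) (w : List Symbol) :
    haltList (p.machine .io) (List.map id w) = { Store.empty with io := w }.cfg none := by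
  refine congrArg (TM2.Cfg.mk _ _) ?_
  funext k
  cases k <;> first | rfl | exact List.map_id w

theorem haltList_machine_left (p : Prog) (w : List Bool) :
    haltList (p.machine .left) (List.map id w) = { Store.empty with left := w }.cfg none := by
  refine congrArg (TM2.Cfg.mk _ _) ?_
  funext k
  cases k <;> first | rfl | exact List.map_id w

theorem nonempty_computable_io {α β : Type} {ea : α → List Symbol} {eb : β → List Symbol}
    {f : α → β} (p : Prog) (P : Polynomial ℕ)
    (h : ∀ a, ∃ t ≤ P.eval (ea a).length,
      Exec p { Store.empty with io := ea a } { Store.empty with io := eb (f a) } t) :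
    Nonempty (TM2ComputableInPolyTime ea eb f) := by
  -- The summand `1` pays for the halting statement.
  refine ⟨⟨⟨p.machine .io, Equiv.refl _, Equiv.refl _⟩, P + 1, fun a => ?_⟩⟩
  choose t ht h using h
  refine ⟨⟨t a + 1, ?_⟩, ?_⟩
  · have := (h a).evalsTo .io
    rw [← initList_machine, ← haltList_machine_io] at this
    exact this
  · simpa using ht a

theorem nonempty_computable_left {α : Type} {ea : α → List Symbol} {f : α → Bool} (p : Prog)
    (P : Polynomial ℕ)
    (h : ∀ a, ∃ t ≤ P.eval (ea a).length,
      Exec p { Store.empty with io := ea a } { Store.empty with left := [f a] } t) :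
    Nonempty (TM2ComputableInPolyTime ea Computability.encodeBool f) := by
  refine ⟨⟨⟨p.machine .left, Equiv.refl _, Equiv.refl _⟩, P + 1, fun a => ?_⟩⟩
  choose t ht h using h
  refine ⟨⟨t a + 1, ?_⟩, ?_⟩
  · have := (h a).evalsTo .left
    rw [← initList_machine, ← haltList_machine_left] at this
    exact this
  · simpa using ht a

end ColorAvoiding

namespace ColorAvoiding

/-! ### Binary trees on a stack -/

/-- Binary trees. -/
inductive BinTree
  | nil
  | node (l r : BinTree)

namespace BinTree

/-- The preorder code of a binary tree. -/
def code : BinTree → List Bool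
  | nil => [false]
  | node l r => true :: (l.code ++ r.code)

/-- The number of nodes and leaves. -/
def size : BinTree → ℕ
  | nil => 1
  | node l r => l.size + r.size + 1

/-- The left subtree. -/
def fst : BinTree → BinTree
  | nil => nil
  | node l _ => l

/-- The right subtree. -/
def snd : BinTree → BinTree
  | nil => nil
  | node _ r => r

theorem length_code (t : BinTree) : t.code.length = t.size := by
  induction t with
  | nil => rfl
  | node l r hl hr => simp [code, size, hl, hr]

end BinTree

/-! ### Executions with upper bounds for the running time. -/

/-- `ExecIn p s s' n`: the program `p`, started with the store `s`, stops with the store `s'` after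
at most `n` steps. -/
def ExecIn (p : Prog) (s s' : Store) (n : ℕ) : Prop := ∃ t ≤ n, Exec p s s' t

namespace ExecIn

theorem op (o : Op) (s : Store) : ExecIn (.op o) s (o.run s) 1 := ⟨1, le_rfl, .op o s⟩

theorem mono {p : Prog} {s s' : Store} {m n : ℕ} (h : ExecIn p s s' m) (hmn : m ≤ n) :
    ExecIn p s s' n := by
  obtain ⟨t, ht, h⟩ := h
  exact ⟨t, ht.trans hmn, h⟩

theorem seq {p q : Prog} {s s' s'' : Store} {m n : ℕ} (h : ExecIn p s s' m)
    (h' : ExecIn q s' s'' n) : ExecIn (.seq p q) s s'' (m + n) := by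
  obtain ⟨t, ht, h⟩ := h
  obtain ⟨t', ht', h'⟩ := h'
  exact ⟨t + t', add_le_add ht ht', h.seq h'⟩

theorem ite_true {c : Reg → Bool} {p q : Prog} {s s' : Store} {n : ℕ} (hc : c s.reg = true)
    (h : ExecIn p s s' n) : ExecIn (.ite c p q) s s' (n + 1) := by
  obtain ⟨t, ht, h⟩ := h
  exact ⟨t + 1, by omega, .ite_true hc h⟩

theorem ite_false {c : Reg → Bool} {p q : Prog} {s s' : Store} {n : ℕ} (hc : c s.reg = false)
    (h : ExecIn q s s' n) : ExecIn (.ite c p q) s s' (n + 1) := by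
  obtain ⟨t, ht, h⟩ := h
  exact ⟨t + 1, by omega, .ite_false hc h⟩

theorem loop_halt {c : Reg → Bool} {p : Prog} {s : Store} (hc : c s.reg = false) :
    ExecIn (.loop c p) s s 1 := ⟨1, le_rfl, .loop_halt hc⟩

theorem loop_step {c : Reg → Bool} {p : Prog} {s s' s'' : Store} {m n : ℕ} (hc : c s.reg = true)
    (h : ExecIn p s s' m) (h' : ExecIn (.loop c p) s' s'' n) :
    ExecIn (.loop c p) s s'' (m + n + 1) := by
  obtain ⟨t, ht, h⟩ := h
  obtain ⟨t', ht', h'⟩ := h'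
  exact ⟨t + t' + 1, by omega, .loop_step hc h h'⟩

end ExecIn

/-! ### Programs that manipulate the topmost trees. -/

namespace Prog

/-- One round of `scan`. -/
def scanStep (k : Work) : Prog :=
  seq (op (.pop .main)) <| seq (op (.pushReg k)) <|
    seq (ite Reg.bit (op (.push .count [true])) (op (.pop .count))) (op (.peek .count))

/-- Move the topmost tree from the main stack to another stack, where its code is reversed. -/
def scan (k : Work) : Prog :=
  seq (op (.push .count [true])) <| seq (op (.peek .count)) <| loop Option.isSome (scanStep k)

/-- Move the content of a stack to other stacks. -/
def pour (k : Work) (p : Prog) : Prog :=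
  seq (op (.pop k)) <| loop Option.isSome (seq p (op (.pop k)))

/-- Remove the topmost tree. -/
def drop : Prog := seq (scan .left) (pour .left (op (.push .main [])))

/-- Exchange the two topmost trees. -/
def swap : Prog :=
  seq (scan .left) <| seq (scan .right) <| seq (pour .left (op (.pushReg .main)))
    (pour .right (op (.pushReg .main)))

/-- Duplicate the topmost tree. -/
def dup : Prog :=
  seq (scan .left) <| seq (pour .left (seq (op (.pushReg .main)) (op (.pushReg .right)))) <|
    seq (pour .right (op (.pushReg .left))) (pour .left (op (.pushReg .main)))

/-- Replace the topmost tree by its left subtree. -/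
def fst : Prog :=
  seq (op (.pop .main)) (ite Reg.bit (seq swap drop) (op (.push .main [false])))

/-- Replace the topmost tree by its right subtree. -/
def snd : Prog := seq (op (.pop .main)) (ite Reg.bit drop (op (.push .main [false])))

/-- Remove the topmost tree and remember whether it was a leaf. -/
def test : Prog :=
  seq (op (.pop .main)) <|
    ite Reg.bit (seq drop (seq drop (seq (op (.push .count [true])) (op (.pop .count)))))
      (op (.push .main []))

end Prog

open Prog BinTree

/-- The counter holds in unary the number of trees still to be read: the mark of a node replaces one
tree by two, a leaf completes one. The hypothesis `h` describes the run after `t` has been read, so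
that the case of a node chains the two induction hypotheses. -/
theorem execIn_scan_left_loop (t : BinTree) {v : Reg} {io : List Symbol} {m l r c : List Bool}
    {s : Store} {n : ℕ}
    (h : ExecIn (.loop Option.isSome (scanStep .left))
      ⟨c.head?.map some, io, m, t.code.reverse ++ l, r, c⟩ s n) (hv : v.isSome = true) :
    ExecIn (.loop Option.isSome (scanStep .left)) ⟨v, io, t.code ++ m, l, r, true :: c⟩ s
      (n + 6 * t.size) := by
  induction t generalizing v m l c n with
  | nil =>
    refine (ExecIn.loop_step (m := 5) hv ?_ h).mono (by simp only [size]; omega)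
    exact (ExecIn.op _ _).seq ((ExecIn.op _ _).seq ((ExecIn.ite_false rfl (.op _ _)).seq (.op _ _)))
  | node a b ha hb =>
    simp only [code, List.reverse_cons, List.reverse_append, List.append_assoc] at h
    have h₁ := ha (hb h (v := ((true :: c).head?.map some)) rfl) (v := some (some true)) rfl
    refine (ExecIn.loop_step (m := 5) hv ?_ h₁).mono (by simp only [size]; omega)
    simp only [code, List.cons_append, List.append_assoc]
    exact (ExecIn.op _ _).seq ((ExecIn.op _ _).seq ((ExecIn.ite_true rfl (.op _ _)).seq (.op _ _)))

theorem execIn_scan_right_loop (t : BinTree) {v : Reg} {io : List Symbol} {m l r c : List Bool}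
    {s : Store} {n : ℕ}
    (h : ExecIn (.loop Option.isSome (scanStep .right))
      ⟨c.head?.map some, io, m, l, t.code.reverse ++ r, c⟩ s n) (hv : v.isSome = true) :
    ExecIn (.loop Option.isSome (scanStep .right)) ⟨v, io, t.code ++ m, l, r, true :: c⟩ s
      (n + 6 * t.size) := by
  induction t generalizing v m r c n with
  | nil =>
    refine (ExecIn.loop_step (m := 5) hv ?_ h).mono (by simp only [size]; omega)
    exact (ExecIn.op _ _).seq ((ExecIn.op _ _).seq ((ExecIn.ite_false rfl (.op _ _)).seq (.op _ _)))
  | node a b ha hb =>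
    simp only [code, List.reverse_cons, List.reverse_append, List.append_assoc] at h
    have h₁ := ha (hb h (v := ((true :: c).head?.map some)) rfl) (v := some (some true)) rfl
    refine (ExecIn.loop_step (m := 5) hv ?_ h₁).mono (by simp only [size]; omega)
    simp only [code, List.cons_append, List.append_assoc]
    exact (ExecIn.op _ _).seq ((ExecIn.op _ _).seq ((ExecIn.ite_true rfl (.op _ _)).seq (.op _ _)))

theorem execIn_scan_left (t : BinTree) (v : Reg) (io : List Symbol) (m l r : List Bool) :
    ExecIn (scan .left) ⟨v, io, t.code ++ m, l, r, []⟩ ⟨none, io, m, t.code.reverse ++ l, r, []⟩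
      (6 * t.size + 3) :=
  ((ExecIn.op _ _).seq ((ExecIn.op _ _).seq
    (execIn_scan_left_loop t (.loop_halt rfl) rfl))).mono (by omega)

theorem execIn_scan_right (t : BinTree) (v : Reg) (io : List Symbol) (m l r : List Bool) :
    ExecIn (scan .right) ⟨v, io, t.code ++ m, l, r, []⟩ ⟨none, io, m, l, t.code.reverse ++ r, []⟩
      (6 * t.size + 3) :=
  ((ExecIn.op _ _).seq ((ExecIn.op _ _).seq
    (execIn_scan_right_loop t (.loop_halt rfl) rfl))).mono (by omega)

/-- The family `f` describes the store by the register, the bits left on the source stack and the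
reversed list of the bits already taken. Different choices of `f` cover all destinations. -/
theorem execIn_pour {k : Work} {p : Prog} {d : ℕ} (f : Reg → List Bool → List Bool → Store)
    (hr : ∀ v l a, (f v l a).reg = v)
    (hf : ∀ v l a, (Op.pop k).run (f v l a) = f (l.head?.map some) l.tail a)
    (hp : ∀ b l a, ExecIn p (f (some (some b)) l a) (f (some (some b)) l (b :: a)) d)
    (v : Reg) (l a : List Bool) :
    ExecIn (pour k p) (f v l a) (f none [] (l.reverse ++ a)) (l.length * (d + 2) + 2) := by
  have hf' : ∀ v l a, ExecIn (.op (.pop k)) (f v l a) (f (l.head?.map some) l.tail a) 1 :=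
    fun v l a => hf v l a ▸ .op _ _
  have H : ∀ l a : List Bool, ExecIn (.loop Option.isSome (seq p (op (.pop k))))
      (f (l.head?.map some) l.tail a) (f none [] (l.reverse ++ a)) (l.length * (d + 2) + 1) := by
    intro l
    induction l with
    | nil => exact fun a => (ExecIn.loop_halt (congrArg Option.isSome (hr _ _ _))).mono (by simp)
    | cons b l ih =>
      intro a
      have h := ih (b :: a)
      simp only [List.reverse_cons, List.append_assoc, List.length_cons]
      refine (ExecIn.loop_step (by rw [hr]; rfl) ((hp b l a).seq (hf' _ l (b :: a))) h).mono ?_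
      rw [Nat.succ_mul]
      omega
  exact ((hf' v l a).seq (H l a)).mono (by omega)

theorem execIn_pour_left_main (v : Reg) (io : List Symbol) (m l r c : List Bool) :
    ExecIn (pour .left (op (.pushReg .main))) ⟨v, io, m, l, r, c⟩
      ⟨none, io, l.reverse ++ m, [], r, c⟩ (l.length * 3 + 2) :=
  execIn_pour (fun v l m => ⟨v, io, m, l, r, c⟩) (fun _ _ _ => rfl) (fun _ _ _ => rfl)
    (fun b _ _ => by cases b <;> exact .op _ _) v l m

theorem execIn_pour_right_main (v : Reg) (io : List Symbol) (m l r c : List Bool) :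
    ExecIn (pour .right (op (.pushReg .main))) ⟨v, io, m, l, r, c⟩
      ⟨none, io, r.reverse ++ m, l, [], c⟩ (r.length * 3 + 2) :=
  execIn_pour (fun v r m => ⟨v, io, m, l, r, c⟩) (fun _ _ _ => rfl) (fun _ _ _ => rfl)
    (fun b _ _ => by cases b <;> exact .op _ _) v r m

theorem execIn_pour_right_left (v : Reg) (io : List Symbol) (m l r c : List Bool) :
    ExecIn (pour .right (op (.pushReg .left))) ⟨v, io, m, l, r, c⟩
      ⟨none, io, m, r.reverse ++ l, [], c⟩ (r.length * 3 + 2) :=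
  execIn_pour (fun v r l => ⟨v, io, m, l, r, c⟩) (fun _ _ _ => rfl) (fun _ _ _ => rfl)
    (fun b _ _ => by cases b <;> exact .op _ _) v r l

theorem execIn_pour_left_both (v : Reg) (io : List Symbol) (m l c : List Bool) :
    ExecIn (pour .left (seq (op (.pushReg .main)) (op (.pushReg .right)))) ⟨v, io, m, l, [], c⟩
      ⟨none, io, l.reverse ++ m, [], l.reverse, c⟩ (l.length * 4 + 2) := by
  -- The bits taken so far appear twice: on top of `m` and on the stack `right`.
  have h := execIn_pour (fun v l a => ⟨v, io, a ++ m, l, a, c⟩) (fun _ _ _ => rfl)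
    (fun _ _ _ => rfl) (k := .left) (p := seq (op (.pushReg .main)) (op (.pushReg .right))) (d := 2)
    (fun b _ _ => by cases b <;> exact (ExecIn.op _ _).seq (.op _ _)) v l []
  simpa only [List.append_nil, List.nil_append] using h

/-- The store that has only a main stack. -/
def Store.tops (v : Reg) (m : List Bool) : Store := ⟨v, [], m, [], [], []⟩

open Store

theorem execIn_drop (t : BinTree) (v : Reg) (m : List Bool) :
    ExecIn drop (tops v (t.code ++ m)) (tops none m) (9 * t.size + 5) := by
  -- Pushing the empty list does nothing, so the popped bits are lost and the store ignores the
  -- third argument of the family.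
  refine ((execIn_scan_left t v [] m [] []).seq (execIn_pour (k := .left) (p := op (.push .main []))
    (d := 1) (fun v l _ => ⟨v, [], m, l, [], []⟩) (fun _ _ _ => rfl) (fun _ _ _ => rfl)
    (fun b _ _ => .op _ _) none _ [])).mono ?_
  simp [length_code]
  omega

theorem execIn_swap (t u : BinTree) (v : Reg) (m : List Bool) :
    ExecIn swap (tops v (t.code ++ (u.code ++ m))) (tops none (u.code ++ (t.code ++ m)))
      (9 * (t.size + u.size) + 10) := by
  have h := (execIn_scan_left t v [] (u.code ++ m) [] []).seq
    ((execIn_scan_right u none [] m (t.code.reverse ++ []) []).seq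
      ((execIn_pour_left_main none [] m (t.code.reverse ++ []) (u.code.reverse ++ []) []).seq
        (execIn_pour_right_main none [] _ [] (u.code.reverse ++ []) [])))
  simp only [List.append_nil, List.reverse_reverse, List.length_reverse, length_code] at h
  exact h.mono (by omega)

/-- Every pour reverses. The copy on `right` has the orientation of the code itself and must pass
through `left` to reach the main stack unreversed. -/
theorem execIn_dup (t : BinTree) (v : Reg) (m : List Bool) :
    ExecIn dup (tops v (t.code ++ m)) (tops none (t.code ++ (t.code ++ m)))
      (16 * t.size + 9) := by
  have h := (execIn_scan_left t v [] m [] []).seq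
    ((execIn_pour_left_both none [] m (t.code.reverse ++ []) []).seq
      ((execIn_pour_right_left none [] _ [] _ []).seq (execIn_pour_left_main none [] _ _ [] [])))
  simp only [List.append_nil, List.reverse_reverse, List.length_reverse, length_code] at h
  exact h.mono (by omega)

theorem execIn_fst (t : BinTree) (v : Reg) (m : List Bool) :
    ∃ v', ExecIn Prog.fst (tops v (t.code ++ m)) (tops v' (t.fst.code ++ m)) (18 * t.size + 17) := by
  cases t with
  | nil => exact ⟨_, ((ExecIn.op _ _).seq (.ite_false rfl (.op _ _))).mono (by simp)⟩
  | node a b =>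
    have h := (ExecIn.op (.pop .main) (tops v (true :: (a.code ++ (b.code ++ m))))).seq
      (.ite_true (c := Reg.bit) (q := op (.push .main [false])) rfl
        ((execIn_swap a b (some (some true)) m).seq (execIn_drop b none (a.code ++ m))))
    simp only [code, List.cons_append, List.append_assoc]
    exact ⟨none, h.mono (by simp only [size]; omega)⟩

theorem execIn_snd (t : BinTree) (v : Reg) (m : List Bool) :
    ∃ v', ExecIn Prog.snd (tops v (t.code ++ m)) (tops v' (t.snd.code ++ m)) (9 * t.size + 7) := by
  cases t with
  | nil => exact ⟨_, ((ExecIn.op _ _).seq (.ite_false rfl (.op _ _))).mono (by simp)⟩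
  | node a b =>
    have h := (ExecIn.op (.pop .main) (tops v (true :: (a.code ++ (b.code ++ m))))).seq
      (.ite_true (c := Reg.bit) (q := op (.push .main [false])) rfl
        (execIn_drop a (some (some true)) (b.code ++ m)))
    simp only [code, List.cons_append, List.append_assoc]
    exact ⟨none, h.mono (by simp only [size]; omega)⟩

open Classical in
theorem execIn_test (t : BinTree) (v : Reg) (m : List Bool) :
    ExecIn test (tops v (t.code ++ m)) (tops (some (some (decide (t ≠ .nil)))) m)
      (9 * t.size + 14) := by
  cases t with
  | nil => simpa using! ((ExecIn.op _ _).seq (.ite_false rfl (.op _ _))).mono (by simp)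
  | node a b =>
    -- Dropping the subtrees clears the register; a bit pushed on the counter and popped again sets
    -- it to true.
    have h := (execIn_drop a (some (some true)) (b.code ++ m)).seq ((execIn_drop b none m).seq
      ((ExecIn.op (.push .count [true]) _).seq (.op (.pop .count) _)))
    have h' := (ExecIn.op (.pop .main) (tops v (true :: (a.code ++ (b.code ++ m))))).seq
      (.ite_true (c := Reg.bit) (q := op (.push .main [])) rfl h)
    simp only [code, List.cons_append, List.append_assoc, ne_eq, reduceCtorEq, not_false_eq_true,
      decide_true]
    exact h'.mono (by simp only [size]; omega)

/-! ### Polynomial-time functions -/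

theorem Polynomial.eval_mono_nat (P : Polynomial ℕ) {m n : ℕ} (h : m ≤ n) : P.eval m ≤ P.eval n := by
  induction P using Polynomial.induction_on' with
  | add p q hp hq => simpa using add_le_add hp hq
  | monomial k a => simpa using Nat.mul_le_mul_left a (Nat.pow_le_pow_left h k)

/-- Data that is represented by binary trees. -/
class TreeCode (α : Type) where
  /-- the tree that represents an element -/
  enc : α → BinTree

open TreeCode (enc)

variable {ι α β γ σ : Type} [TreeCode ι] [TreeCode α] [TreeCode β] [TreeCode γ] [TreeCode σ]

/-- The size of the tree that represents an element. -/
def sz (a : α) : ℕ := (enc a).size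

/-- Functions that can be computed in polynomial time on the topmost tree of the main stack. -/
@[fun_prop]
def PT (f : α → β) : Prop :=
  ∃ (p : Prog) (P : Polynomial ℕ), ∀ a, sz (f a) ≤ P.eval (sz a) ∧
    ∀ v m, ∃ v', ExecIn p (tops v ((enc a).code ++ m)) (tops v' ((enc (f a)).code ++ m))
      (P.eval (sz a))

instance : TreeCode BinTree := ⟨fun t => t⟩

instance : TreeCode Unit := ⟨fun _ => .nil⟩

instance : TreeCode Bool := ⟨fun b => bif b then .node .nil .nil else .nil⟩

instance : TreeCode (α × β) := ⟨fun x => .node (enc x.1) (enc x.2)⟩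

/-- Lists are nested pairs. -/
def encList : List α → BinTree
  | [] => .nil
  | a :: l => .node (enc a) (encList l)

instance : TreeCode (List α) := ⟨encList⟩

/-- Numbers are written in unary. -/
def encNat : ℕ → BinTree
  | 0 => .nil
  | n + 1 => .node .nil (encNat n)

instance : TreeCode ℕ := ⟨encNat⟩

instance : TreeCode (Option α) :=
  ⟨fun x => match x with
    | none => .nil
    | some a => .node .nil (enc a)⟩

namespace PT

theorem exists_sz_le {f : α → β} (hf : PT f) : ∃ P : Polynomial ℕ, ∀ x, sz (f x) ≤ P.eval (sz x) := by
  obtain ⟨_, P, h⟩ := hf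
  exact ⟨P, fun x => (h x).1⟩

/-- A program sees only trees, so it serves for all types with the same codes. Basic operations on
lists, options and numbers are reduced in this way to operations on trees. -/
theorem of_enc_eq {α' β' : Type} [TreeCode α'] [TreeCode β'] {f : α → β} (hf : PT f) {f' : α' → β'}
    (φ : α' → α) (hφ : ∀ a, enc (φ a) = enc a) (h : ∀ a, enc (f (φ a)) = enc (f' a)) : PT f' := by
  obtain ⟨p, P, hf⟩ := hf
  refine ⟨p, P, fun a => ?_⟩
  have := hf (φ a)
  simpa only [sz, hφ, h] using this

theorem treeFst : PT BinTree.fst := by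
  refine ⟨Prog.fst, 18 * .X + 17, fun x => ⟨?_, fun v m => ?_⟩⟩
  · cases x <;> simp [sz, enc, BinTree.fst, BinTree.size]; omega
  · simpa using! execIn_fst x v m

theorem treeSnd : PT BinTree.snd := by
  refine ⟨Prog.snd, 9 * .X + 7, fun x => ⟨?_, fun v m => ?_⟩⟩
  · cases x <;> simp [sz, enc, BinTree.snd, BinTree.size]; omega
  · simpa using! execIn_snd x v m

@[fun_prop]
theorem id : PT fun x : α => x :=
  ⟨op .clear, .X + 1, fun x => ⟨by simp, fun v m => ⟨_, (ExecIn.op _ _).mono (by simp)⟩⟩⟩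

theorem nil : PT fun _ : α => BinTree.nil := by
  refine ⟨seq drop (op (.push .main [false])), 9 * .X + 6,
    fun x => ⟨by simp [sz, enc, BinTree.size], ?_⟩⟩
  intro v m
  exact ⟨none, ((execIn_drop (enc x) v m).seq (.op _ _)).mono (by simp [sz])⟩

-- This is where the size bound in `PT` is needed: the time spent on `g` is polynomial in the size
-- of `f x`.
@[fun_prop]
theorem comp {g : β → γ} {f : α → β} (hg : PT g) (hf : PT f) : PT fun x => g (f x) := by
  obtain ⟨p, P, hf⟩ := hf
  obtain ⟨q, Q, hg⟩ := hg
  refine ⟨seq p q, P + Q.comp P, fun x => ?_⟩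
  obtain ⟨h₁, h₂⟩ := hf x
  obtain ⟨h₃, h₄⟩ := hg (f x)
  have hQ := Polynomial.eval_mono_nat Q h₁
  simp only [Polynomial.eval_add, Polynomial.eval_comp]
  refine ⟨by omega, fun v m => ?_⟩
  obtain ⟨v₁, h₁⟩ := h₂ v m
  obtain ⟨v₂, h₂⟩ := h₄ v₁ m
  exact ⟨v₂, (h₁.seq h₂).mono (by omega)⟩

@[fun_prop]
theorem pair {f : α → β} {g : α → γ} (hf : PT f) (hg : PT g) : PT fun x => (f x, g x) := by
  obtain ⟨p, P, hf⟩ := hf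
  obtain ⟨q, Q, hg⟩ := hg
  -- The second component is computed first, so that the first one ends on top of it, and the pushed
  -- bit turns the two codes into that of a node.
  refine ⟨seq dup (seq q (seq swap (seq p (op (.push .main [true]))))),
    P + 20 * Q + 30 * .X + 50, fun x => ?_⟩
  obtain ⟨h₁, h₂⟩ := hf x
  obtain ⟨h₃, h₄⟩ := hg x
  simp only [Polynomial.eval_add, Polynomial.eval_mul, Polynomial.eval_X, Polynomial.eval_ofNat]
  simp only [sz] at *
  refine ⟨by simp only [enc, BinTree.size] at *; omega, fun v m => ?_⟩
  obtain ⟨v₁, e₁⟩ := h₄ none ((enc x).code ++ m)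
  obtain ⟨v₂, e₂⟩ := h₂ none ((enc (g x)).code ++ m)
  have h := (execIn_dup (enc x) v m).seq (e₁.seq ((execIn_swap _ _ _ _).seq
    (e₂.seq (.op (.push .main [true]) _))))
  rw [show enc (f x, g x) = .node (enc (f x)) (enc (g x)) from rfl]
  simp only [code, List.cons_append, List.append_assoc]
  exact ⟨v₂, h.mono (by omega)⟩

-- The condition is evaluated on a copy of the argument, which the test consumes; a leaf plays the
-- role of false.
open Classical in
theorem ite_nil {c : α → γ} {f g : α → β} (hc : PT c) (hf : PT f) (hg : PT g) :
    PT fun x => if enc (c x) = .nil then g x else f x := by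
  obtain ⟨r, R, hc⟩ := hc
  obtain ⟨p, P, hf⟩ := hf
  obtain ⟨q, Q, hg⟩ := hg
  refine ⟨seq dup (seq r (seq test (Prog.ite Reg.bit p q))),
    P + Q + 20 * R + 30 * .X + 50, fun x => ?_⟩
  obtain ⟨h₁, h₂⟩ := hf x
  obtain ⟨h₃, h₄⟩ := hg x
  obtain ⟨h₅, h₆⟩ := hc x
  simp only [Polynomial.eval_add, Polynomial.eval_mul, Polynomial.eval_X, Polynomial.eval_ofNat]
  refine ⟨by split_ifs <;> omega, fun v m => ?_⟩
  simp only [sz] at *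
  obtain ⟨v₁, e₁⟩ := h₆ none ((enc x).code ++ m)
  have e {v₂ : Reg} {y : List Bool} {n : ℕ}
      (h : ExecIn (Prog.ite Reg.bit p q)
        (tops (some (some (decide (enc (c x) ≠ .nil)))) ((enc x).code ++ m)) (tops v₂ y) n) :=
    (execIn_dup (enc x) v m).seq (e₁.seq ((execIn_test (enc (c x)) v₁ ((enc x).code ++ m)).seq h))
  split_ifs with hx
  · obtain ⟨v₂, e₂⟩ := h₄ (some (some false)) m
    simp only [hx, ne_eq, not_true_eq_false, decide_false] at e h₅
    exact ⟨v₂, (e (.ite_false rfl e₂)).mono (by omega)⟩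
  · obtain ⟨v₂, e₂⟩ := h₂ (some (some true)) m
    simp only [hx, ne_eq, not_false_eq_true, decide_true] at e
    exact ⟨v₂, (e (.ite_true rfl e₂)).mono (by omega)⟩

/-- The number of rounds is never computed: the loop stops when `c` yields a leaf. The polynomial
`Q` has to bound all intermediate sizes, since iterating a polynomially bounded map can produce
exponential growth. -/
theorem iterate {init : ι → σ} {c : σ → γ} {f : σ → σ} (hi : PT init) (hc : PT c) (hf : PT f)
    (N : ι → ℕ) (Q : Polynomial ℕ) (hN : ∀ x, N x ≤ Q.eval (sz x))
    (hQ : ∀ x, ∀ j ≤ N x, sz (f^[j] (init x)) ≤ Q.eval (sz x))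
    (hlt : ∀ x, ∀ j < N x, enc (c (f^[j] (init x))) ≠ .nil)
    (heq : ∀ x, enc (c (f^[N x] (init x))) = .nil) :
    PT fun x => f^[N x] (init x) := by
  obtain ⟨r, R, hc⟩ := hc
  obtain ⟨p, P, hf⟩ := hf
  obtain ⟨q, S, hi⟩ := hi
  let T : Polynomial ℕ := 20 * Q + 20 * R.comp Q + P.comp Q + 50
  refine ⟨seq q (seq (seq dup (seq r test)) (loop Reg.bit (seq p (seq dup (seq r test))))),
    S + (Q + T + (Q * T + 1)), fun x => ?_⟩
  have hT : T.eval (sz x) = 20 * Q.eval (sz x) + 20 * R.eval (Q.eval (sz x)) +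
    P.eval (Q.eval (sz x)) + 50 := by simp [T, Polynomial.eval_comp]
  simp only [Polynomial.eval_add, Polynomial.eval_mul, Polynomial.eval_one]
  refine ⟨(hQ x _ le_rfl).trans (by omega), fun v m => ?_⟩
  classical
  have htest : ∀ j ≤ N x, ∀ v,
      ExecIn (seq dup (seq r test)) (tops v ((enc (f^[j] (init x))).code ++ m))
        (tops (some (some (decide (enc (c (f^[j] (init x))) ≠ .nil))))
          ((enc (f^[j] (init x))).code ++ m))
        (20 * Q.eval (sz x) + 20 * R.eval (Q.eval (sz x)) + 40) := by
    intro j hj v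
    obtain ⟨h₁, h₂⟩ := hc (f^[j] (init x))
    have hR := Polynomial.eval_mono_nat R (hQ x j hj)
    have hs := hQ x j hj
    obtain ⟨v₁, e₁⟩ := h₂ none ((enc (f^[j] (init x))).code ++ m)
    refine ((execIn_dup _ v m).seq (e₁.seq (execIn_test _ _ _))).mono ?_
    simp only [sz] at *
    omega
  -- Induction on the number `i` of rounds that remain.
  have hloop : ∀ i ≤ N x, ∃ v', ExecIn (loop Reg.bit (seq p (seq dup (seq r test))))
      (tops (some (some (decide (enc (c (f^[N x - i] (init x))) ≠ .nil))))
        ((enc (f^[N x - i] (init x))).code ++ m))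
      (tops v' ((enc (f^[N x] (init x))).code ++ m)) (i * T.eval (sz x) + 1) := by
    intro i
    induction i with
    | zero =>
      intro _
      refine ⟨_, (ExecIn.loop_halt ?_).mono (by omega)⟩
      simp [heq, tops]; rfl
    | succ i ih =>
      intro hi
      obtain ⟨v', h⟩ := ih (by omega)
      refine ⟨v', ?_⟩
      have hP := Polynomial.eval_mono_nat P (hQ x (N x - (i + 1)) (by omega))
      obtain ⟨v₁, e₁⟩ := (hf (f^[N x - (i + 1)] (init x))).2
        (some (some (decide (enc (c (f^[N x - (i + 1)] (init x))) ≠ .nil)))) m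
      rw [← Function.iterate_succ_apply' f, show (N x - (i + 1)).succ = N x - i by omega] at e₁
      refine (ExecIn.loop_step ?_ (e₁.seq (htest (N x - i) (by omega) v₁)) h).mono ?_
      · have := hlt x (N x - (i + 1)) (by omega)
        simp [this, tops]; rfl
      · rw [add_mul, one_mul]
        omega
  obtain ⟨v', h⟩ := hloop (N x) le_rfl
  rw [Nat.sub_self] at h
  obtain ⟨v₀, h₀⟩ := (hi x).2 v m
  refine ⟨v', (h₀.seq ((htest 0 (by omega) v₀).seq h)).mono ?_⟩
  have := Nat.mul_le_mul_right (T.eval (sz x)) (hN x)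
  omega

@[fun_prop]
theorem fst : PT (Prod.fst : α × β → α) := treeFst.of_enc_eq enc (fun _ => rfl) fun _ => rfl

@[fun_prop]
theorem snd : PT (Prod.snd : α × β → β) := treeSnd.of_enc_eq enc (fun _ => rfl) fun _ => rfl

@[fun_prop]
theorem const (b : β) : PT fun _ : α => b := by
  suffices H : ∀ t : BinTree, PT fun _ : α => t from
    (H (enc b)).of_enc_eq (fun a => a) (fun _ => rfl) fun _ => rfl
  intro t
  induction t with
  | nil => exact nil
  | node l r hl hr => exact (pair hl hr).of_enc_eq (fun a => a) (fun _ => rfl) fun _ => rfl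

end PT

end ColorAvoiding

namespace ColorAvoiding

open Prog BinTree
open TreeCode (enc)

variable {ι α β γ σ : Type} [TreeCode ι] [TreeCode α] [TreeCode β] [TreeCode γ] [TreeCode σ]

/-! ### Sizes -/

theorem sz_pair (a : α) (b : β) : sz (a, b) = sz a + sz b + 1 := rfl

theorem sz_nil : sz ([] : List α) = 1 := rfl

theorem sz_cons (a : α) (l : List α) : sz (a :: l) = sz a + sz l + 1 := rfl

theorem sz_nat (n : ℕ) : sz n = 2 * n + 1 := by
  induction n with
  | zero => rfl
  | succ n ih =>
    rw [show sz (n + 1) = 1 + sz n + 1 from rfl, ih]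
    omega

theorem sz_bool_le (b : Bool) : sz b ≤ 3 := by
  cases b <;> simp [sz, enc, size]

/-- Concatenation replaces the leaf that ends the first list by the tree of the second. -/
theorem sz_append (l₁ l₂ : List α) : sz (l₁ ++ l₂) + 1 = sz l₁ + sz l₂ := by
  induction l₁ with
  | nil => simp [sz_nil, add_comm]
  | cons a l ih => simp only [List.cons_append, sz_cons]; omega

theorem sz_reverse (l : List α) : sz l.reverse = sz l := by
  induction l with
  | nil => rfl
  | cons a l ih =>
    have := sz_append l.reverse [a]
    simp only [List.reverse_cons, sz_cons, sz_nil] at *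
    omega

theorem sz_le_of_sublist {l₁ l₂ : List α} (h : l₁.Sublist l₂) : sz l₁ ≤ sz l₂ := by
  induction h with
  | slnil => exact le_rfl
  | cons a _ ih => simp only [sz_cons]; omega
  | cons_cons a _ ih => simp only [sz_cons]; omega

theorem sz_le_of_mem {a : α} {l : List α} (h : a ∈ l) : sz a ≤ sz l := by
  have := sz_le_of_sublist (List.singleton_sublist.2 h)
  simp only [sz_cons, sz_nil] at this
  omega

theorem length_le_sz (l : List α) : l.length ≤ sz l := by
  induction l with
  | nil => exact Nat.zero_le _
  | cons a l ih => simp only [sz_cons, List.length_cons]; omega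

theorem sz_le_length_mul {l : List α} {B : ℕ} (h : ∀ a ∈ l, sz a ≤ B) :
    sz l ≤ l.length * (B + 1) + 1 := by
  induction l with
  | nil => simp [sz_nil]
  | cons a l ih =>
    have h₁ := h a (by simp)
    have h₂ := ih fun b hb => h b (by simp [hb])
    rw [sz_cons, List.length_cons, Nat.succ_mul]
    omega

namespace PT

/-! ### Case distinctions -/

@[fun_prop]
theorem cond {c : α → Bool} {f g : α → β} (hc : PT c) (hf : PT f) (hg : PT g) :
    PT fun x => bif c x then f x else g x := by
  classical
  refine (ite_nil hc hf hg).of_enc_eq (fun x => x) (fun _ => rfl) fun x => ?_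
  cases h : c x <;> simp [enc]

@[fun_prop]
theorem and {f g : α → Bool} (hf : PT f) (hg : PT g) : PT fun x => f x && g x := by
  have : PT fun x => bif f x then g x else false := by fun_prop
  convert! this using 2 with x
  cases f x <;> rfl

@[fun_prop]
theorem or {f g : α → Bool} (hf : PT f) (hg : PT g) : PT fun x => f x || g x := by
  have : PT fun x => bif f x then true else g x := by fun_prop
  exact this

@[fun_prop]
theorem not {f : α → Bool} (hf : PT f) : PT fun x => !f x := by
  have : PT fun x => bif f x then false else true := by fun_prop
  exact this

@[fun_prop]
theorem bool_beq {f g : α → Bool} (hf : PT f) (hg : PT g) : PT fun x => f x == g x := by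
  have : PT fun x => bif f x then g x else !g x := by fun_prop
  convert! this using 2 with x
  cases f x <;> cases g x <;> rfl

/-! ### Lists -/

@[fun_prop]
theorem cons {f : α → β} {g : α → List β} (hf : PT f) (hg : PT g) : PT fun x => f x :: g x :=
  (pair hf hg).of_enc_eq (fun x => x) (fun _ => rfl) fun _ => rfl

@[fun_prop]
theorem tail {f : α → List β} (hf : PT f) : PT fun x => (f x).tail := by
  have h : PT fun x => (enc (f x)).snd :=
    treeSnd.comp (hf.of_enc_eq (f' := fun x => enc (f x)) (fun x => x) (fun _ => rfl) fun _ => rfl)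
  refine h.of_enc_eq (fun x => x) (fun _ => rfl) fun x => ?_
  cases f x <;> rfl

@[fun_prop]
theorem headD {f : α → List β} {d : α → β} (hf : PT f) (hd : PT d) :
    PT fun x => (f x).headD (d x) := by
  classical
  have h₁ : PT fun x => (enc (f x)).fst :=
    treeFst.comp (hf.of_enc_eq (f' := fun x => enc (f x)) (fun x => x) (fun _ => rfl) fun _ => rfl)
  have h₂ : PT fun x => enc (d x) := hd.of_enc_eq (fun x => x) (fun _ => rfl) fun _ => rfl
  refine (ite_nil hf h₁ h₂).of_enc_eq (fun x => x) (fun _ => rfl) fun x => ?_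
  cases h : f x <;> simp [enc, encList, BinTree.fst]

@[fun_prop]
theorem isEmpty {f : α → List β} (hf : PT f) : PT fun x => (f x).isEmpty := by
  classical
  refine (ite_nil hf (const false) (const true)).of_enc_eq (fun x => x) (fun _ => rfl) fun x => ?_
  cases h : f x <;> simp [enc, encList]

omit [TreeCode ι] [TreeCode α] [TreeCode σ] in
theorem iterate_foldl_step [Inhabited α] (step : ι → σ → α → σ) (c : ι) (l : List α) (s : σ) (j : ℕ)
    (hj : j ≤ l.length) :
    (fun x : ι × σ × List α => (x.1, step x.1 x.2.1 (x.2.2.headD default), x.2.2.tail))^[j] (c, s, l) =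
      (c, (l.take j).foldl (step c) s, l.drop j) := by
  induction j generalizing l s with
  | zero => simp
  | succ j ih =>
    cases l with
    | nil => simp at hj
    | cons a l =>
      rw [Function.iterate_succ_apply]
      have := ih l (step c s a) (by simpa using hj)
      simpa using this

/-- The fold is an iteration on triples of context, accumulator and remaining list, which stops when
that list is a leaf. The accumulators reached on prefixes are the intermediate results to be
bounded. -/
theorem foldl [Inhabited α] {l : ι → List α} {init : ι → σ} {step : ι → σ → α → σ} (hl : PT l)
    (hi : PT init) (hs : PT fun p : ι × σ × α => step p.1 p.2.1 p.2.2) (P : Polynomial ℕ)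
    (hP : ∀ c, ∀ l₁, l₁ <+: l c → sz (l₁.foldl (step c) (init c)) ≤ P.eval (sz c)) :
    PT fun c => (l c).foldl (step c) (init c) := by
  obtain ⟨Q, hQ⟩ := hl.exists_sz_le
  have hf : PT fun x : ι × σ × List α =>
      (x.1, step x.1 x.2.1 (x.2.2.headD default), x.2.2.tail) := by
    have h : PT fun x : ι × σ × List α => (x.1, x.2.1, x.2.2.headD default) := by fun_prop
    have := hs.comp h
    fun_prop
  have h := iterate (ι := ι) (init := fun c => (c, init c, l c)) (c := fun x => x.2.2) (by fun_prop)
    (by fun_prop) hf (fun c => (l c).length) (.X + P + Q + 2) (fun c => ?_) (fun c j hj => ?_)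
    (fun c j hj => ?_) (fun c => ?_)
  · have h₁ : PT fun c => ((l c).foldl (step c) (init c)) := by
      have h' := (snd.comp h)
      have h'' := (fst.comp h')
      refine h''.of_enc_eq (fun x => x) (fun _ => rfl) fun c => ?_
      rw [iterate_foldl_step step c (l c) (init c) _ le_rfl]
      simp
    exact h₁
  · have := length_le_sz (l c)
    have := hQ c
    simp only [Polynomial.eval_add, Polynomial.eval_X, Polynomial.eval_ofNat]
    omega
  · rw [iterate_foldl_step step c (l c) (init c) _ hj]
    have h₁ := hQ c
    have h₂ := hP c _ (List.take_prefix j (l c))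
    have h₃ := sz_le_of_sublist (List.drop_sublist j (l c))
    simp only [sz_pair, Polynomial.eval_add, Polynomial.eval_X, Polynomial.eval_ofNat]
    omega
  · rw [iterate_foldl_step step c (l c) (init c) _ hj.le]
    have : (l c).drop j ≠ [] := by simpa using hj
    cases h : (l c).drop j with
    | nil => exact absurd h this
    | cons a l' => exact BinTree.noConfusion
  · rw [iterate_foldl_step step c (l c) (init c) _ le_rfl]
    simp only [List.drop_length]
    rfl

omit [TreeCode α] [TreeCode β] in
theorem foldl_cons_eq {l : List α} {l' : List β} (f : α → β) :
    l.foldl (fun acc a => f a :: acc) l' = (l.map f).reverse ++ l' := by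
  induction l generalizing l' with
  | nil => rfl
  | cons a l ih => simp [ih]

@[fun_prop]
theorem reverse [Inhabited β] {f : α → List β} (hf : PT f) : PT fun x => (f x).reverse := by
  obtain ⟨P, hP⟩ := hf.exists_sz_le
  have h := foldl (init := fun _ => []) (step := fun _ acc a => a :: acc) hf (by fun_prop)
    (by fun_prop) P fun c l₁ h => ?_
  · convert! h using 2 with x
    simp
  · have := foldl_cons_eq (l := l₁) (l' := []) fun a => a
    rw [this]
    simp only [List.map_id', List.append_nil, sz_reverse]
    exact (sz_le_of_sublist h.sublist).trans (hP c)

@[fun_prop]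
theorem append [Inhabited β] {f g : α → List β} (hf : PT f) (hg : PT g) :
    PT fun x => f x ++ g x := by
  obtain ⟨P, hP⟩ := hf.exists_sz_le
  obtain ⟨Q, hQ⟩ := hg.exists_sz_le
  have h := foldl (init := g) (step := fun _ acc a => a :: acc) hf.reverse hg (by fun_prop) (P + Q)
    fun c l₁ h => ?_
  · convert! h using 2 with x
    simp
  · rw [foldl_cons_eq (l := l₁) (l' := g c) fun a => a]
    have h₁ := sz_le_of_sublist h.sublist
    have h₂ := hP c
    have h₃ := hQ c
    have h₄ := sz_append l₁.reverse (g c)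
    simp only [List.map_id', sz_reverse, Polynomial.eval_add] at *
    omega

@[fun_prop]
theorem map [Inhabited β] [Inhabited γ] {l : α → List β} {f : α → β → γ} (hl : PT l)
    (hf : PT fun p : α × β => f p.1 p.2) : PT fun x => (l x).map (f x) := by
  obtain ⟨P, hP⟩ := hl.exists_sz_le
  obtain ⟨Q, hQ⟩ := hf.exists_sz_le
  have h := foldl (init := fun _ => []) (step := fun x acc a => f x a :: acc) hl (by fun_prop)
    (by
      have h : PT fun p : α × List γ × β => (p.1, p.2.2) := by fun_prop
      have := hf.comp h
      fun_prop) (P * (Q.comp (.X + P + 1) + 1) + 1) fun c l₁ h => ?_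
  · convert! h.reverse using 2 with x
    simp
  · rw [foldl_cons_eq, List.append_nil, sz_reverse]
    have hB : ∀ b ∈ l₁.map (f c), sz b ≤ Q.eval (sz c + P.eval (sz c) + 1) := by
      intro b hb
      obtain ⟨a, ha, rfl⟩ := List.mem_map.1 hb
      refine (hQ (c, a)).trans (Polynomial.eval_mono_nat Q ?_)
      have := (sz_le_of_mem (h.subset ha)).trans (hP c)
      simp only [sz_pair]
      omega
    refine (sz_le_length_mul hB).trans ?_
    have h₁ : l₁.length ≤ P.eval (sz c) :=
      (h.length_le.trans (length_le_sz _)).trans (hP c)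
    simp only [Polynomial.eval_add, Polynomial.eval_mul, Polynomial.eval_comp, Polynomial.eval_X,
      Polynomial.eval_one, List.length_map]
    gcongr

@[fun_prop]
theorem all [Inhabited β] {l : α → List β} {p : α → β → Bool} (hl : PT l)
    (hp : PT fun x : α × β => p x.1 x.2) : PT fun x => (l x).all (p x) := by
  have h := foldl (init := fun _ => true) (step := fun x acc a => acc && p x a) hl (by fun_prop)
    (by
      have h : PT fun x : α × Bool × β => (x.1, x.2.2) := by fun_prop
      have := hp.comp h
      fun_prop) 3 fun c l₁ _ => by simpa using sz_bool_le _
  convert! h using 2 with x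
  have key : ∀ (l : List β) (b : Bool),
      l.foldl (fun acc a => acc && p x a) b = (b && l.all (p x)) := by
    intro l
    induction l with
    | nil => simp
    | cons a l ih => simp [ih, Bool.and_assoc]
  simp [key]

@[fun_prop]
theorem any [Inhabited β] {l : α → List β} {p : α → β → Bool} (hl : PT l)
    (hp : PT fun x : α × β => p x.1 x.2) : PT fun x => (l x).any (p x) := by
  have h := not (all (p := fun x a => !p x a) hl (not hp))
  convert! h using 2 with x
  simp [List.all_eq_not_any_not]

@[fun_prop]
theorem filter [Inhabited β] {l : α → List β} {p : α → β → Bool} (hl : PT l)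
    (hp : PT fun x : α × β => p x.1 x.2) : PT fun x => (l x).filter (p x) := by
  obtain ⟨P, hP⟩ := hl.exists_sz_le
  have key (x : α) : ∀ (l l' : List β),
      l.foldl (fun acc a => bif p x a then a :: acc else acc) l' = (l.filter (p x)).reverse ++ l' := by
    intro l
    induction l with
    | nil => simp
    | cons a l ih => intro l'; cases h : p x a <;> simp [ih, h]
  have h := foldl (init := fun _ => []) (step := fun x acc a => bif p x a then a :: acc else acc) hl
    (by fun_prop)
    (by
      have h : PT fun x : α × List β × β => (x.1, x.2.2) := by fun_prop
      have := hp.comp h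
      fun_prop) P fun c l₁ h => ?_
  · convert! h.reverse using 2 with x
    simp [key]
  · rw [key, List.append_nil, sz_reverse]
    exact (sz_le_of_sublist (List.filter_sublist.trans h.sublist)).trans (hP c)

@[fun_prop]
theorem flatten [Inhabited β] {l : α → List (List β)} (hl : PT l) : PT fun x => (l x).flatten := by
  obtain ⟨P, hP⟩ := hl.exists_sz_le
  have h₂ (l : List (List β)) : sz l.flatten ≤ sz l := by
    induction l with
    | nil => exact le_rfl
    | cons a l ih =>
      have := sz_append a l.flatten
      simp only [List.flatten_cons, sz_cons] at *
      omega
  have key : ∀ (l : List (List β)) (l' : List β),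
      l.foldl (fun acc a => acc ++ a) l' = l' ++ l.flatten := by
    intro l
    induction l with
    | nil => simp
    | cons a l ih => intro l'; simp [ih]
  have h := foldl (init := fun _ => []) (step := fun _ acc a => acc ++ a) hl
    (by fun_prop) (by fun_prop) P fun c l₁ h => ?_
  · convert! h using 2 with x
    simp [key]
  · rw [key]
    exact (h₂ l₁).trans ((sz_le_of_sublist h.sublist).trans (hP c))

@[fun_prop]
theorem flatMap [Inhabited β] [Inhabited γ] {l : α → List β} {f : α → β → List γ} (hl : PT l)
    (hf : PT fun p : α × β => f p.1 p.2) : PT fun x => (l x).flatMap (f x) := by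
  simp only [List.flatMap_def]
  exact flatten (map hl hf)

/-- A fold over the first list carries a bit, whether all entries agreed so far, and the unread rest
of the second list; that rest must be empty at the end. -/
theorem list_beq [Inhabited β] [BEq β] (h : PT fun p : β × β => p.1 == p.2) {f g : α → List β}
    (hf : PT f) (hg : PT g) : PT fun x => f x == g x := by
  obtain ⟨P, hP⟩ := hg.exists_sz_le
  let step : α → Bool × List β → β → Bool × List β := fun _ s b =>
    (s.1 && (!s.2.isEmpty && b == s.2.headD default), s.2.tail)
  have key (x : α) : ∀ (l l' : List β) (b : Bool),
      (l.foldl (step x) (b, l')).2 = l'.drop l.length ∧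
      ((l.foldl (step x) (b, l')).1 && (l.foldl (step x) (b, l')).2.isEmpty) = (b && l == l') := by
    intro l
    induction l with
    | nil => intro l' b; cases l' <;> simp
    | cons a l ih =>
      intro l' b
      simp only [List.foldl_cons, step]
      refine ⟨?_, ?_⟩
      · rw [(ih _ _).1]; simp
      · rw [(ih _ _).2]
        cases l' <;> simp [Bool.and_assoc]
  have hs : PT fun p : α × (Bool × List β) × β => step p.1 p.2.1 p.2.2 := by
    have h' : PT fun p : α × (Bool × List β) × β => (p.2.2, p.2.1.2.headD default) := by fun_prop
    have := h.comp h'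
    fun_prop
  have h' := foldl (init := fun x => (true, g x)) (step := step) hf (by fun_prop) hs (P + 4)
    fun c l₁ _ => ?_
  · have : PT fun x => ((f x).foldl (step x) (true, g x)).1 &&
      ((f x).foldl (step x) (true, g x)).2.isEmpty := by fun_prop
    convert! this using 2 with x
    simp [(key x (f x) (g x) true).2]
  · have h₁ := sz_bool_le (l₁.foldl (step c) (true, g c)).1
    have h₂ := sz_le_of_sublist (List.drop_sublist l₁.length (g c))
    have h₃ := hP c
    rw [← (key c l₁ (g c) true).1] at h₂
    rw [← Prod.mk.eta (p := l₁.foldl (step c) (true, g c)), sz_pair]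
    simp only [Polynomial.eval_add, Polynomial.eval_ofNat]
    omega

@[fun_prop]
theorem isNone {f : α → Option β} (hf : PT f) : PT fun x => (f x).isNone := by
  classical
  refine (ite_nil hf (const false) (const true)).of_enc_eq (fun x => x) (fun _ => rfl) fun x => ?_
  cases h : f x <;> simp [enc]

@[fun_prop]
theorem optionGetD {f : α → Option Bool} (hf : PT f) : PT fun x => (f x).getD false := by
  have h : PT fun x => (enc (f x)).snd :=
    treeSnd.comp (hf.of_enc_eq (f' := fun x => enc (f x)) (fun x => x) (fun _ => rfl) fun _ => rfl)
  refine h.of_enc_eq (fun x => x) (fun _ => rfl) fun x => ?_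
  rcases f x with _ | _ | _ <;> rfl

@[fun_prop]
theorem bits_beq {f g : α → List Bool} (hf : PT f) (hg : PT g) : PT fun x => f x == g x :=
  list_beq (bool_beq fst snd) hf hg

@[fun_prop]
theorem rows_beq {f g : α → List (List Bool)} (hf : PT f) (hg : PT g) : PT fun x => f x == g x :=
  list_beq (bits_beq fst snd) hf hg

/-! ### Numbers -/

/-- A unary number and a list of units are the same tree, so arithmetic and bounded iteration reduce
to lists. -/
theorem enc_replicate (n : ℕ) : enc (List.replicate n ()) = enc n := by
  induction n with
  | zero => rfl
  | succ n ih => exact congrArg (BinTree.node .nil) ih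

@[fun_prop]
theorem units {f : α → ℕ} (hf : PT f) : PT fun x => List.replicate (f x) () :=
  hf.of_enc_eq (fun x => x) (fun _ => rfl) fun x => (enc_replicate (f x)).symm

@[fun_prop]
theorem length [Inhabited β] {f : α → List β} (hf : PT f) : PT fun x => (f x).length := by
  have := map (f := fun _ _ => ()) hf (by fun_prop)
  refine this.of_enc_eq (fun x => x) (fun _ => rfl) fun x => ?_
  rw [← enc_replicate, List.map_const']

@[fun_prop]
theorem add {f g : α → ℕ} (hf : PT f) (hg : PT g) : PT fun x => f x + g x := by
  have : PT fun x => (List.replicate (f x) () ++ List.replicate (g x) ()).length := by fun_prop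
  simpa using this

@[fun_prop]
theorem replicate [Inhabited β] {f : α → ℕ} {g : α → β} (hf : PT f) (hg : PT g) :
    PT fun x => List.replicate (f x) (g x) := by
  have := map (f := fun x _ => g x) hf.units (by fun_prop)
  simpa using this

@[fun_prop]
theorem nat_beq {f g : α → ℕ} (hf : PT f) (hg : PT g) : PT fun x => f x == g x := by
  have := list_beq (β := Unit) ((const true).of_enc_eq (fun x => x) (fun _ => rfl) fun _ => rfl)
    hf.units hg.units
  convert! this using 2 with x
  rw [Bool.eq_iff_iff]
  simp

theorem iterate_nat {n : α → ℕ} {init : α → σ} {step : α → σ → σ} (hn : PT n) (hi : PT init)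
    (hs : PT fun p : α × σ => step p.1 p.2) (P : Polynomial ℕ)
    (hP : ∀ c, ∀ j ≤ n c, sz ((step c)^[j] (init c)) ≤ P.eval (sz c)) :
    PT fun c => (step c)^[n c] (init c) := by
  have key (c : α) (l : List Unit) (s : σ) :
      l.foldl (fun s _ => step c s) s = (step c)^[l.length] s := by
    induction l generalizing s with
    | nil => rfl
    | cons a l ih => simp [ih]
  have h := foldl (step := fun c s (_ : Unit) => step c s) hn.units hi
    (by
      have h : PT fun x : α × σ × Unit => (x.1, x.2.1) := by fun_prop
      exact hs.comp h) P fun c l₁ h => ?_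
  · convert! h using 2 with x
    simp [key]
  · rw [key]
    exact hP c _ (by simpa using h.length_le)

@[fun_prop]
theorem drop {n : α → ℕ} {f : α → List β} (hn : PT n) (hf : PT f) : PT fun x => (f x).drop (n x) := by
  obtain ⟨P, hP⟩ := hf.exists_sz_le
  have key (l : List β) (j : ℕ) : List.tail^[j] l = l.drop j := by
    induction j generalizing l with
    | zero => rfl
    | succ j ih => simp [ih]
  have h := iterate_nat (step := fun _ l => l.tail) hn hf (by fun_prop) P fun c j _ => ?_
  · convert! h using 2 with x
    exact (key _ _).symm
  · rw [key]
    exact (sz_le_of_sublist (List.drop_sublist _ _)).trans (hP c)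

@[fun_prop]
theorem getD {n : α → ℕ} {f : α → List β} {d : α → β} (hn : PT n) (hf : PT f) (hd : PT d) :
    PT fun x => (f x).getD (n x) (d x) := by
  have : PT fun x => ((f x).drop (n x)).headD (d x) := by fun_prop
  convert! this using 2 with x
  simp [List.headD_eq_head?_getD]

@[fun_prop]
theorem range {n : α → ℕ} (hn : PT n) : PT fun x => List.range (n x) := by
  obtain ⟨P, hP⟩ := hn.exists_sz_le
  have key (j : ℕ) : (fun l : List ℕ => l ++ [l.length])^[j] [] = List.range j := by
    induction j with
    | zero => rfl
    | succ j ih => simp [Function.iterate_succ_apply', ih, List.range_succ]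
  have h := iterate_nat (init := fun _ => []) (step := fun _ l => l ++ [l.length]) hn (by fun_prop)
    (by fun_prop) (P * (P + 1) + 1) fun c j hj => ?_
  · convert! h using 2 with x
    exact (key _).symm
  · rw [key]
    have h₁ := hP c
    rw [sz_nat] at h₁
    have : ∀ a ∈ List.range j, sz a ≤ P.eval (sz c) := by
      intro a ha
      rw [List.mem_range] at ha
      rw [sz_nat]
      omega
    refine (sz_le_length_mul this).trans ?_
    simp only [Polynomial.eval_add, Polynomial.eval_mul, Polynomial.eval_one, List.length_range]
    gcongr
    omega

end PT

end ColorAvoiding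

namespace ColorAvoiding

open Prog BinTree Store
open TreeCode (enc)

/-! ### Input and output -/

namespace Prog

/-- Push the tree of a symbol and the mark of a node. -/
def loadSymbol : Prog :=
  ite (fun v => v == some none) (op (.push .main [true, false])) <|
    ite (fun v => v == some (some false)) (op (.push .main [true, true, false, false]))
      (op (.push .main [true, true, false, true, false, false]))

/-- Turn the input into a tree. -/
def loadInput : Prog :=
  seq (op .popSym) <| seq (op (.push .main [false])) <|
    loop Option.isSome (seq loadSymbol (op .popSym))

/-- Write the symbol whose tree is on the top of the main stack. -/
def writeSymbol : Prog :=
  seq (op (.pop .main)) <| ite Reg.bit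
    (seq (op (.pop .main)) <| seq (op (.pop .main)) <| ite Reg.bit
      (seq (op (.pop .main)) (seq (op (.pop .main)) (op (.pushSym (some true)))))
      (op (.pushSym (some false))))
    (op (.pushSym none))

/-- Write a list of symbols. -/
def writeOutput : Prog :=
  seq (op (.pop .main)) <| seq (loop Reg.bit (seq writeSymbol (op (.pop .main)))) (op .clear)

/-- Write a bit. -/
def writeBit : Prog :=
  seq test (seq (op (.pushReg .left)) (op .clear))

end Prog

/-- Symbols are put in front of the list as they are read, so the word arrives reversed. Writing
reverses as well, which is why the algorithms below are defined on reversed words. -/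
theorem execIn_loadInput_loop (w acc : List Symbol) :
    ExecIn (loop Option.isSome (seq loadSymbol (op .popSym)))
      ⟨w.head?, w.tail, (enc acc).code, [], [], []⟩
      (tops none (enc (w.reverse ++ acc)).code) (w.length * 5 + 1) := by
  induction w generalizing acc with
  | nil => exact (ExecIn.loop_halt rfl).mono (by simp)
  | cons a w ih =>
    have h := ih (a :: acc)
    rw [List.reverse_cons, List.append_assoc, List.length_cons]
    refine (ExecIn.loop_step (m := 4) rfl ?_ h).mono (by omega)
    rcases a with _ | _ | _
    · exact ((ExecIn.ite_true rfl (.op _ _)).seq (.op _ _)).mono (by omega)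
    · exact ((ExecIn.ite_false rfl (.ite_true rfl (.op _ _))).seq (.op _ _)).mono (by omega)
    · exact ((ExecIn.ite_false rfl (.ite_false rfl (.op _ _))).seq (.op _ _)).mono (by omega)

theorem execIn_loadInput (w : List Symbol) :
    ExecIn loadInput { Store.empty with io := w } (tops none (enc w.reverse).code)
      (w.length * 5 + 3) := by
  have h := execIn_loadInput_loop w []
  rw [List.append_nil] at h
  exact ((ExecIn.op _ _).seq ((ExecIn.op _ _).seq h)).mono (by omega)

theorem execIn_writeOutput_loop (y acc : List Symbol) :
    ExecIn (loop Reg.bit (seq writeSymbol (op (.pop .main))))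
      ⟨(enc y).code.head?.map some, acc, (enc y).code.tail, [], [], []⟩
      ⟨some (some false), y.reverse ++ acc, [], [], [], []⟩ (y.length * 10 + 1) := by
  induction y generalizing acc with
  | nil => exact (ExecIn.loop_halt rfl).mono (by simp)
  | cons a y ih =>
    have h := ih (a :: acc)
    rw [List.reverse_cons, List.append_assoc, List.length_cons]
    refine (ExecIn.loop_step (m := 9) rfl ?_ h).mono (by omega)
    rcases a with _ | _ | _
    · exact (((ExecIn.op _ _).seq (.ite_false rfl (.op _ _))).seq (.op _ _)).mono (by omega)
    · exact (((ExecIn.op _ _).seq (.ite_true rfl ((ExecIn.op _ _).seq ((ExecIn.op _ _).seq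
        (.ite_false rfl (.op _ _)))))).seq (.op _ _)).mono (by omega)
    · exact (((ExecIn.op _ _).seq (.ite_true rfl ((ExecIn.op _ _).seq ((ExecIn.op _ _).seq
        (.ite_true rfl ((ExecIn.op _ _).seq ((ExecIn.op _ _).seq
          (.op _ _)))))))).seq (.op _ _)).mono (by omega)

theorem execIn_writeOutput (v : Reg) (y : List Symbol) :
    ExecIn writeOutput (tops v (enc y).code) { Store.empty with io := y.reverse }
      (y.length * 10 + 3) := by
  have h := execIn_writeOutput_loop y []
  rw [List.append_nil] at h
  exact ((ExecIn.op _ _).seq (h.seq (.op _ _))).mono (by omega)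

open Classical in
theorem execIn_writeBit (v : Reg) (b : Bool) :
    ExecIn writeBit (tops v (enc b).code) { Store.empty with left := [b] } 50 := by
  have h := execIn_test (enc b) v []
  rw [List.append_nil] at h
  have hb : sz b ≤ 3 := sz_bool_le b
  rw [sz] at hb
  rw [show decide (enc b ≠ nil) = b by cases b <;> simp [enc]] at h
  have h' := (h.seq ((ExecIn.op (.pushReg .left) _).seq (.op .clear _))).mono (n := 50) (by omega)
  cases b <;> exact h'

/-- The tree of a symbol has at most five nodes and leaves; the list adds one node for each symbol
and a final leaf. -/
theorem sz_word_le (w : List Symbol) : sz w ≤ 6 * w.length + 1 := by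
  refine (sz_le_length_mul (B := 5) fun a _ => ?_).trans (by omega)
  rcases a with _ | _ | _ <;> simp [sz, enc, size]

theorem PT.execIn_word {β : Type} [TreeCode β] {F : List Symbol → β} (hF : PT F) {q : Prog}
    {out : β → Store} {Q : Polynomial ℕ}
    (hq : ∀ v y, ExecIn q (tops v (enc y).code) (out y) (Q.eval (sz y))) :
    ∃ (p : Prog) (P : Polynomial ℕ), ∀ w : List Symbol,
      ExecIn p { Store.empty with io := w } (out (F w.reverse)) (P.eval w.length) := by
  obtain ⟨p, P, h⟩ := hF
  refine ⟨seq loadInput (seq p q), 5 * .X + 3 + (P.comp (6 * .X + 1) +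
    Q.comp (P.comp (6 * .X + 1))), fun w => ?_⟩
  obtain ⟨h₁, h₂⟩ := h w.reverse
  obtain ⟨v, h₂⟩ := h₂ none []
  rw [List.append_nil, List.append_nil] at h₂
  refine ((execIn_loadInput w).seq (h₂.seq (hq v _))).mono ?_
  have h₃ := Polynomial.eval_mono_nat P (sz_word_le w.reverse)
  have h₄ := Polynomial.eval_mono_nat Q (h₁.trans h₃)
  rw [List.length_reverse] at h₃ h₄
  simp only [Polynomial.eval_add, Polynomial.eval_mul, Polynomial.eval_comp, Polynomial.eval_X,
    Polynomial.eval_ofNat, Polynomial.eval_one]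
  omega

theorem PT.nonempty_computable_word {α β : Type} {ea : α → List Symbol} {eb : β → List Symbol}
    {f : α → β} {F : List Symbol → List Symbol} (hF : PT F)
    (h : ∀ a, F (ea a).reverse = (eb (f a)).reverse) :
    Nonempty (TM2ComputableInPolyTime ea eb f) := by
  obtain ⟨p, P, hp⟩ := hF.execIn_word (out := fun y => { Store.empty with io := y.reverse })
    (Q := 10 * .X + 3) fun v y => (execIn_writeOutput v y).mono (by
      have := length_le_sz y
      simp only [Polynomial.eval_add, Polynomial.eval_mul, Polynomial.eval_X, Polynomial.eval_ofNat]
      omega)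
  refine nonempty_computable_io p P fun a => ?_
  have := hp (ea a)
  rw [h, List.reverse_reverse] at this
  exact this

theorem PT.nonempty_computable_bool {α : Type} {ea : α → List Symbol} {f : α → Bool}
    {F : List Symbol → Bool} (hF : PT F) (h : ∀ a, F (ea a).reverse = f a) :
    Nonempty (TM2ComputableInPolyTime ea Computability.encodeBool f) := by
  obtain ⟨p, P, hp⟩ := hF.execIn_word (out := fun b => { Store.empty with left := [b] })
    (Q := 50) fun v y => by simpa using! execIn_writeBit v y
  refine nonempty_computable_left p P fun a => ?_
  have := hp (ea a)
  rw [h] at this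
  exact this

end ColorAvoiding

namespace ColorAvoiding

open TreeCode (enc)

/-! ### The algorithm on the rows of a multicolored graph -/

/-- An entry of a table of bits. -/
def bitAt (R : List (List Bool)) (i j : ℕ) : Bool := (R.getD i []).getD j false

/-- The number of vertices. -/
def numVertices (R : List (List Bool)) : ℕ := (R.getD 0 []).length

/-- The number of colors. -/
def numColors (R : List (List Bool)) : ℕ := (R.getD 1 []).length

/-- The row with the colors of a vertex. -/
def colorRow (R : List (List Bool)) (v : ℕ) : List Bool := R.getD (2 + numVertices R + v) []

/-- Whether a vertex is destroyed by the attack on a color. No vertex is destroyed by the attack on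
a number that is not a color. -/
def isKilled (R : List (List Bool)) (v i : ℕ) : Bool :=
  (colorRow R v).getD i false && colorRow R v == (List.range (numColors R)).map fun j => j == i

/-- Whether two vertices are adjacent after an attack. -/
def isEdge (R : List (List Bool)) (i u v : ℕ) : Bool :=
  bitAt R (2 + u) v && (!isKilled R u i && !isKilled R v i)

/-- Add to a set of vertices its neighbors after an attack. -/
def expand (R : List (List Bool)) (i : ℕ) (S : List Bool) : List Bool :=
  (List.range (numVertices R)).map fun v =>
    S.getD v false || (List.range (numVertices R)).any fun w => S.getD w false && isEdge R i w v

/-- The vertices that are reachable from a vertex after an attack. -/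
def reachSet (R : List (List Bool)) (i u : ℕ) : List Bool :=
  (expand R i)^[numVertices R] ((List.range (numVertices R)).map fun v => v == u)

/-- Whether two vertices are weakly color-avoiding connected. -/
def isWeak (R : List (List Bool)) (u v : ℕ) : Bool :=
  (List.range (numColors R + 1)).all fun i =>
    isKilled R u i || (isKilled R v i || (reachSet R i u).getD v false)

/-- The vertices that are weakly color-avoiding connected to two vertices. -/
def commonSet (R : List (List Bool)) (u v : ℕ) : List Bool :=
  (List.range (numVertices R)).map fun w => isWeak R u w && isWeak R v w

/-- Whether any two elements of a set are weakly color-avoiding connected. -/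
def isClique (R : List (List Bool)) (S : List Bool) : Bool :=
  (List.range (numVertices R)).all fun u => !S.getD u false ||
    (List.range (numVertices R)).all fun v => !S.getD v false || isWeak R u v

/-- The weakly color-avoiding connected components, possibly with repetitions. -/
def components (R : List (List Bool)) : List (List Bool) :=
  bif (List.range (numVertices R)).isEmpty then [[]] else
    (List.range (numVertices R)).flatMap fun u => (List.range (numVertices R)).flatMap fun v =>
      bif isWeak R u v && isClique R (commonSet R u v) then [commonSet R u v] else []

/-- Remove repetitions. -/
def removeDup (L : List (List Bool)) : List (List Bool) :=
  L.foldl (fun acc S => bif acc.any fun T => S == T then acc else S :: acc) []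

/-! ### Polynomial running time of the algorithm on rows. -/

namespace PT

variable {α : Type} [TreeCode α] {R : α → List (List Bool)} {i j u v : α → ℕ} {S : α → List Bool}

@[fun_prop]
theorem bitAt (hR : PT R) (hi : PT i) (hj : PT j) : PT fun x => bitAt (R x) (i x) (j x) := by
  unfold ColorAvoiding.bitAt
  fun_prop

@[fun_prop]
theorem numVertices (hR : PT R) : PT fun x => numVertices (R x) := by
  unfold ColorAvoiding.numVertices
  fun_prop

@[fun_prop]
theorem numColors (hR : PT R) : PT fun x => numColors (R x) := by
  unfold ColorAvoiding.numColors
  fun_prop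

@[fun_prop]
theorem colorRow (hR : PT R) (hv : PT v) : PT fun x => colorRow (R x) (v x) := by
  unfold ColorAvoiding.colorRow
  fun_prop

@[fun_prop]
theorem isKilled (hR : PT R) (hv : PT v) (hi : PT i) : PT fun x => isKilled (R x) (v x) (i x) := by
  unfold ColorAvoiding.isKilled
  fun_prop

@[fun_prop]
theorem isEdge (hR : PT R) (hi : PT i) (hu : PT u) (hv : PT v) :
    PT fun x => isEdge (R x) (i x) (u x) (v x) := by
  unfold ColorAvoiding.isEdge
  fun_prop

@[fun_prop]
theorem expand (hR : PT R) (hi : PT i) (hS : PT S) : PT fun x => expand (R x) (i x) (S x) := by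
  unfold ColorAvoiding.expand
  fun_prop

-- Every iterate is a vector with one bit for each vertex, so the intermediate sizes stay linear in
-- `n`.
@[fun_prop]
theorem reachSet (hR : PT R) (hi : PT i) (hu : PT u) : PT fun x => reachSet (R x) (i x) (u x) := by
  obtain ⟨P, hP⟩ := hR.numVertices.exists_sz_le
  unfold ColorAvoiding.reachSet
  refine iterate_nat (step := fun x => ColorAvoiding.expand (R x) (i x)) (by fun_prop)
    (by fun_prop) (by fun_prop) (4 * P + 1) fun c j _ => ?_
  refine (sz_le_length_mul (B := 3) fun b _ => sz_bool_le b).trans ?_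
  have hlen : ∀ j, ((ColorAvoiding.expand (R c) (i c))^[j]
      ((List.range (ColorAvoiding.numVertices (R c))).map fun v => v == u c)).length =
      ColorAvoiding.numVertices (R c) := by
    intro j
    cases j with
    | zero => simp
    | succ j => simp [Function.iterate_succ_apply', ColorAvoiding.expand]
  have h := hP c
  rw [sz_nat] at h
  rw [hlen]
  simp only [Polynomial.eval_add, Polynomial.eval_mul, Polynomial.eval_one, Polynomial.eval_ofNat]
  omega

@[fun_prop]
theorem isWeak (hR : PT R) (hu : PT u) (hv : PT v) : PT fun x => isWeak (R x) (u x) (v x) := by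
  unfold ColorAvoiding.isWeak
  fun_prop

@[fun_prop]
theorem commonSet (hR : PT R) (hu : PT u) (hv : PT v) :
    PT fun x => commonSet (R x) (u x) (v x) := by
  unfold ColorAvoiding.commonSet
  fun_prop

@[fun_prop]
theorem isClique (hR : PT R) (hS : PT S) : PT fun x => isClique (R x) (S x) := by
  unfold ColorAvoiding.isClique
  fun_prop

@[fun_prop]
theorem components (hR : PT R) : PT fun x => components (R x) := by
  unfold ColorAvoiding.components
  fun_prop

@[fun_prop]
theorem removeDup (hR : PT R) : PT fun x => removeDup (R x) := by
  obtain ⟨P, hP⟩ := hR.exists_sz_le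
  unfold ColorAvoiding.removeDup
  refine foldl (init := fun _ => [])
    (step := fun _ acc S => bif acc.any fun T => S == T then acc else S :: acc) hR
    (by fun_prop) (by fun_prop) P fun c l h => ?_
  have key : ∀ l acc : List (List Bool),
      sz (l.foldl (fun acc S => bif acc.any fun T => S == T then acc else S :: acc) acc) + 1 ≤
        sz l + sz acc := by
    intro l
    induction l with
    | nil => simp [sz_nil, add_comm]
    | cons a l ih =>
      intro acc
      refine (ih _).trans ?_
      simp only [Bool.cond_eq_ite]
      split_ifs <;> simp only [sz_cons] <;> omega
  have h₁ := key l []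
  have h₂ := (sz_le_of_sublist h.sublist).trans (hP c)
  rw [sz_nil] at h₁
  omega

end PT

/-! ### Parsing -/

/-- Add a symbol in front of the word that encodes a list of bit strings. -/
def parseStep (acc : List (List Bool)) (a : Symbol) : List (List Bool) :=
  bif a.isNone then [] :: acc else
    bif acc.isEmpty then [] else (a.getD false :: acc.headD []) :: acc.tail

/-- The list of bit strings that is encoded by the reversal of a word. -/
def parse (w : List Symbol) : List (List Bool) := w.foldl parseStep []

/-- Add a carry to a bit. -/
def incStep (s : Bool × List Bool) (b : Bool) : Bool × List Bool :=
  (s.1 && b, (bif s.1 then !b else b) :: s.2)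

/-- Write the last carry. -/
def incResult (s : Bool × List Bool) : List Bool := (bif s.1 then true :: s.2 else s.2).reverse

/-- The number in binary that follows a given one. -/
def incBits (l : List Bool) : List Bool := incResult (l.foldl incStep (true, []))

/-- The rows of a multicolored graph, computed from arbitrary rows. -/
def canonicalRows (R : List (List Bool)) : List (List Bool) :=
  [List.replicate (numVertices R) true, List.replicate (numColors R) true] ++
    ((List.range (numVertices R)).map fun u =>
      (List.range (numVertices R)).map fun v => bitAt R (2 + u) v) ++
    (List.range (numVertices R)).map fun v =>
      (List.range (numColors R)).map fun i => (colorRow R v).getD i false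

/-- Whether some rows are those of a multicolored graph. -/
def isValid (R : List (List Bool)) : Bool :=
  R == canonicalRows R && (List.range (numVertices R)).all fun u => !bitAt R (2 + u) u &&
    (List.range (numVertices R)).all fun v => bitAt R (2 + u) v == bitAt R (2 + v) u

/-- Whether every vertex has a single color. -/
def isSingle (R : List (List Bool)) : Bool :=
  (List.range (numVertices R)).all fun v => (List.range (numColors R)).any fun i => isKilled R v i

/-- Whether a number in binary is positive and at most the size of some component. -/
def isLarge (b : List Bool) (R : List (List Bool)) : Bool :=
  (components R).any fun S => (List.range (S.filter fun b => b).length).any fun j =>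
    b == incBits^[j + 1] []

/-- The decision procedure for multicolored graphs, on the reversed input. -/
def decideMulti (w : List Symbol) : Bool :=
  (w.headD (some true)).isNone &&
    (isValid (parse w).tail && isLarge ((parse w).headD []) (parse w).tail)

/-- The decision procedure for colored graphs, on the reversed input. -/
def decideSingle (w : List Symbol) : Bool :=
  decideMulti w && isSingle (parse w).tail

/-- The enumeration of the components, with reversed input and output. -/
def listComponents (w : List Symbol) : List Symbol :=
  ((removeDup (components (parse w))).flatMap fun S => (S.map fun b => some b) ++ [none]).reverse

/-! ### Polynomial running time of parsing, decision and enumeration. -/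

namespace PT

variable {α : Type} [TreeCode α] {R : α → List (List Bool)} {b : α → List Bool} {n : α → ℕ}

@[fun_prop]
theorem some {f : α → Bool} (hf : PT f) : PT fun x => some (f x) :=
  (pair (const ()) hf).of_enc_eq (fun x => x) (fun _ => rfl) fun _ => rfl

@[fun_prop]
theorem parse {w : α → List Symbol} (hw : PT w) : PT fun x => parse (w x) := by
  suffices h : PT ColorAvoiding.parse from h.comp hw
  refine foldl (step := fun _ => parseStep) id (by fun_prop) (by unfold parseStep; fun_prop) .X
    fun w l h => ?_
  rw [Polynomial.eval_X]
  refine le_trans ?_ (sz_le_of_sublist h.sublist)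
  -- Reading a symbol enlarges the accumulator by no more than the symbol contributes to the size of
  -- the word.
  have key : ∀ (l : List Symbol) (acc : List (List Bool)),
      sz (l.foldl parseStep acc) + 1 ≤ sz l + sz acc := by
    intro l
    induction l with
    | nil => simp [sz_nil, add_comm]
    | cons a l ih =>
      intro acc
      refine (ih _).trans ?_
      rw [sz_cons]
      have h₁ : ∀ b : Bool, sz (Option.some b) = 1 + sz b + 1 := fun b => rfl
      have h₂ : sz (none : Symbol) = 1 := rfl
      rcases a with _ | b
      · simp [parseStep, sz_cons, sz_nil, h₂]
        omega
      · cases acc with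
        | nil =>
          simp [parseStep]
          omega
        | cons r acc =>
          simp [parseStep, sz_cons, h₁]
          omega
  have := key l []
  rw [sz_nil] at this
  omega

theorem length_foldl_incStep (l : List Bool) (s : Bool × List Bool) :
    (l.foldl incStep s).2.length = l.length + s.2.length := by
  induction l generalizing s with
  | nil => simp
  | cons a l ih => simp only [List.foldl_cons, ih, incStep, List.length_cons]; omega

@[fun_prop]
theorem incBits (hb : PT b) : PT fun x => incBits (b x) := by
  suffices h : PT ColorAvoiding.incBits from h.comp hb
  have h : PT fun l : List Bool => l.foldl incStep (true, []) := by
    refine foldl (step := fun _ => incStep) id (by fun_prop) (by unfold incStep; fun_prop)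
      (4 * .X + 5) fun l l' h => ?_
    have h₁ := length_foldl_incStep l' (true, [])
    have h₂ := h.length_le.trans (length_le_sz l)
    have h₃ := sz_bool_le (l'.foldl incStep (true, [])).1
    have h₄ := sz_le_length_mul (B := 3) (l := (l'.foldl incStep (true, [])).2)
      fun b _ => sz_bool_le b
    rw [h₁] at h₄
    rw [← Prod.mk.eta (p := l'.foldl incStep _), sz_pair]
    simp at h₄ ⊢
    omega
  unfold ColorAvoiding.incBits incResult
  fun_prop

theorem length_incBits (l : List Bool) : (ColorAvoiding.incBits l).length ≤ l.length + 1 := by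
  have := length_foldl_incStep l (true, [])
  rw [ColorAvoiding.incBits, incResult, List.length_reverse]
  cases (l.foldl incStep (true, [])).1 <;> simp [this]

@[fun_prop]
theorem incBits_iterate (hn : PT n) : PT fun x => ColorAvoiding.incBits^[n x] [] := by
  obtain ⟨P, hP⟩ := hn.exists_sz_le
  refine iterate_nat (init := fun _ => []) (step := fun _ => ColorAvoiding.incBits) hn (by fun_prop)
    (by fun_prop) (4 * P + 1) fun c j hj => ?_
  have h₁ : ∀ j, (ColorAvoiding.incBits^[j] []).length ≤ j := by
    intro j
    induction j with
    | zero => simp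
    | succ j ih =>
      rw [Function.iterate_succ_apply']
      exact (length_incBits _).trans (by omega)
  have h₂ := sz_le_length_mul (B := 3) (l := ColorAvoiding.incBits^[j] []) fun b _ => sz_bool_le b
  have h₃ := h₁ j
  have h₄ := hP c
  rw [sz_nat] at h₄
  simp only [Polynomial.eval_add, Polynomial.eval_mul, Polynomial.eval_one, Polynomial.eval_ofNat]
  omega

@[fun_prop]
theorem isValid (hR : PT R) : PT fun x => isValid (R x) := by
  unfold ColorAvoiding.isValid canonicalRows
  fun_prop

@[fun_prop]
theorem isSingle (hR : PT R) : PT fun x => isSingle (R x) := by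
  unfold ColorAvoiding.isSingle
  fun_prop

@[fun_prop]
theorem isLarge (hb : PT b) (hR : PT R) : PT fun x => isLarge (b x) (R x) := by
  unfold ColorAvoiding.isLarge
  fun_prop

theorem decideMulti : PT decideMulti := by
  unfold ColorAvoiding.decideMulti
  fun_prop

theorem decideSingle : PT decideSingle := by
  have := PT.decideMulti
  unfold ColorAvoiding.decideSingle
  fun_prop

theorem listComponents : PT listComponents := by
  unfold ColorAvoiding.listComponents
  fun_prop

end PT

end ColorAvoiding

namespace ColorAvoiding

/-! ### The structure of the components -/

section Structure

variable {V C : Type*} {G : SimpleGraph V} {killed : V → C → Prop}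

theorem WeaklyConnected.refl (u : V) : WeaklyConnected G killed u u :=
  ⟨.refl _, fun _ _ _ => .refl _⟩

theorem WeaklyConnected.symm {u v : V} (h : WeaklyConnected G killed u v) :
    WeaklyConnected G killed v u :=
  ⟨h.1.symm, fun i hv hu => (h.2 i hu hv).symm⟩

/-- Weak color-avoiding connectivity passes through a vertex that survives whenever both others do. -/
theorem WeaklyConnected.trans {u v w : V} (h : WeaklyConnected G killed u v)
    (h' : WeaklyConnected G killed v w)
    (hv : ∀ i, ¬ killed u i → ¬ killed w i → killed v i →
      WeaklyAvoidingConnected G killed i u w) :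
    WeaklyConnected G killed u w := by
  refine ⟨h.1.trans h'.1, fun i hu hw => ?_⟩
  by_cases hvi : killed v i
  · exact hv i hu hw hvi hu hw
  · exact (h.2 i hu hvi).trans (h'.2 i hvi hw)

variable [Fintype V] [DecidableEq V]

open Classical in
/-- The vertices that are weakly color-avoiding connected to two given vertices. -/
noncomputable def common (G : SimpleGraph V) (killed : V → C → Prop) (u v : V) : Finset V :=
  {w | WeaklyConnected G killed u w ∧ WeaklyConnected G killed v w}

omit [DecidableEq V] in
theorem mem_common {u v w : V} : w ∈ common G killed u v ↔
    WeaklyConnected G killed u w ∧ WeaklyConnected G killed v w := by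
  simp [common]

/-- The heart of the matter: components are among the common neighborhoods of pairs, so only
quadratically many candidates need to be tested. The hypothesis `hk` excludes that different pairs
of members are destroyed together by different colors. -/
theorem isWeakComponent_iff [Nonempty V] (hk : ∀ v i j, killed v i → killed v j → i = j)
    (S : Finset V) :
    IsWeakComponent G killed S ↔ ∃ u v, WeaklyConnected G killed u v ∧ common G killed u v = S ∧
      ∀ x ∈ common G killed u v, ∀ y ∈ common G killed u v, WeaklyConnected G killed x y := by
  constructor
  · intro hS
    have hne : S.Nonempty := by
      rw [Finset.nonempty_iff_ne_empty]
      rintro rfl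
      obtain ⟨x⟩ := ‹Nonempty V›
      have := hS.2 (y := {x}) (by simpa using WeaklyConnected.refl x) (by simp)
      simp at this
    have hsub : ∀ u ∈ S, ∀ v ∈ S, S ≤ common G killed u v := fun u hu v hv w hw =>
      mem_common.2 ⟨hS.1 u hu w hw, hS.1 v hv w hw⟩
    -- The case `u = v` is allowed and means that `u` is indestructible.
    by_cases h : ∃ u ∈ S, ∃ v ∈ S, ∀ i, killed u i → ¬ killed v i
    · obtain ⟨u, hu, v, hv, huv⟩ := h
      have hcl : ∀ x ∈ common G killed u v, ∀ y ∈ common G killed u v,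
          WeaklyConnected G killed x y := by
        intro x hx y hy
        rw [mem_common] at hx hy
        -- The vertices `x` and `y` are linked through `u`; under the attack that destroys `u` the
        -- link through `v` remains.
        refine hx.1.symm.trans hy.1 fun i hxi hyi hui _ _ => ?_
        have hvi := huv i hui
        exact (hx.2.symm.2 i hxi hvi).trans (hy.2.2 i hvi hyi)
      exact ⟨u, v, hS.1 u hu v hv, (hS.2 hcl (hsub u hu v hv)).antisymm (hsub u hu v hv), hcl⟩
    · push Not at h
      obtain ⟨u, hu⟩ := hne
      obtain ⟨i, hui, -⟩ := h u hu u hu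
      have hall : ∀ s ∈ S, killed s i := fun s hs => by
        obtain ⟨j, hj, hsj⟩ := h u hu s hs
        rwa [hk u i j hui hj]
      have heq : common G killed u u = S := by
        refine le_antisymm (fun w hw => ?_) (hsub u hu u hu)
        have huw := (mem_common.1 hw).1
        -- The link through `u` could fail only for the color `i`, but that color destroys `s` as
        -- well.
        have hws : ∀ s ∈ S, WeaklyConnected G killed s w := fun s hs =>
          (hS.1 s hs u hu).trans huw fun j hsj _ huj =>
            absurd (hk u i j hui huj ▸ hall s hs) hsj
        refine hS.2 (y := insert w S) ?_ (Finset.subset_insert w S) (Finset.mem_insert_self w S)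
        intro x hx y hy
        rw [Finset.mem_insert] at hx hy
        rcases hx with rfl | hx <;> rcases hy with rfl | hy
        · exact .refl _
        · exact (hws y hy).symm
        · exact hws x hx
        · exact hS.1 x hx y hy
      exact ⟨u, u, .refl u, heq, heq ▸ hS.1⟩
  · rintro ⟨u, v, huv, rfl, hcl⟩
    refine ⟨hcl, fun T hT hle w hw => ?_⟩
    have hu : u ∈ T := hle (mem_common.2 ⟨.refl u, huv.symm⟩)
    have hv : v ∈ T := hle (mem_common.2 ⟨huv, .refl v⟩)
    exact mem_common.2 ⟨hT u hu w hw, hT v hv w hw⟩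

omit [Fintype V] [DecidableEq V] in
theorem isWeakComponent_of_isEmpty [IsEmpty V] (S : Finset V) : IsWeakComponent G killed S :=
  ⟨fun u => isEmptyElim u, fun _ _ _ w => isEmptyElim w⟩

/-- The graph that is left after an attack, together with the destroyed vertices. -/
def survivingGraph (G : SimpleGraph V) (dead : V → Prop) : SimpleGraph V where
  Adj u v := G.Adj u v ∧ ¬ dead u ∧ ¬ dead v
  symm := ⟨fun _ _ h => ⟨h.1.symm, h.2.2, h.2.1⟩⟩
  loopless := ⟨fun _ h => h.1.ne rfl⟩

-- Keeping the destroyed vertices as isolated ones avoids subtypes: a walk from a surviving vertex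
-- uses only edges with surviving ends.
omit [Fintype V] [DecidableEq V] in
theorem reachable_induce_iff {dead : V → Prop} {u v : V} (hu : ¬ dead u) (hv : ¬ dead v) :
    (G.induce {w | ¬ dead w}).Reachable ⟨u, hu⟩ ⟨v, hv⟩ ↔ (survivingGraph G dead).Reachable u v := by
  constructor
  · intro h
    exact h.map (⟨Subtype.val, fun {a b} hab => ⟨hab, a.2, b.2⟩⟩ :
      G.induce {w | ¬ dead w} →g survivingGraph G dead)
  · rintro ⟨p⟩
    induction p with
    | nil => exact .refl _
    | @cons u w v h p ih =>
      have hadj : (G.induce {w | ¬ dead w}).Adj ⟨u, hu⟩ ⟨w, h.2.2⟩ := h.1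
      exact hadj.reachable.trans (ih h.2.2 hv)

-- A path has fewer edges than there are vertices, so `Fintype.card V` rounds exhaust the component
-- of `u`.
omit [DecidableEq V] in
theorem mem_iterate_iff_reachable (H : SimpleGraph V) (u : V) (step : (V → Prop) → V → Prop)
    (hstep : ∀ S v, step S v ↔ S v ∨ ∃ w, S w ∧ H.Adj w v) (v : V) :
    step^[Fintype.card V] (fun w => w = u) v ↔ H.Reachable u v := by
  classical
  have sound : ∀ j v, step^[j] (fun w => w = u) v → H.Reachable u v := by
    intro j
    induction j with
    | zero => rintro v rfl; exact .refl _
    | succ j ih =>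
      intro v hv
      rw [Function.iterate_succ_apply', hstep] at hv
      obtain hv | ⟨w, hw, hwv⟩ := hv
      · exact ih v hv
      · exact (ih w hw).trans hwv.reachable
  -- Walks run from `v` back to `u`, so that their first edge is the one added in the last round.
  have complete : ∀ j v, (∃ p : H.Walk v u, p.length ≤ j) → step^[j] (fun w => w = u) v := by
    intro j
    induction j with
    | zero =>
      rintro v ⟨p, hp⟩
      exact p.eq_of_length_eq_zero (by omega)
    | succ j ih =>
      rintro v ⟨p, hp⟩
      rw [Function.iterate_succ_apply', hstep]
      cases p with
      | nil => exact .inl (ih _ ⟨.nil, by simp⟩)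
      | cons h p => exact .inr ⟨_, ih _ ⟨p, by simpa using hp⟩, h.symm⟩
  refine ⟨sound _ v, fun h => complete _ v ?_⟩
  obtain ⟨p, hp⟩ := h.symm.exists_isPath
  exact ⟨p, hp.length_lt.le⟩

end Structure

end ColorAvoiding

namespace ColorAvoiding

/-! ### Correctness of the algorithm -/

theorem getD_map_range {α : Type*} (n : ℕ) (f : ℕ → α) (d : α) {i : ℕ} (hi : i < n) :
    ((List.range n).map f).getD i d = f i := by
  simp [hi]

theorem getD_charVector {m : ℕ} (S : Finset (Fin m)) (i : ℕ) :
    (charVector S).getD i false = true ↔ ∃ h : i < m, ⟨i, h⟩ ∈ S := by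
  by_cases h : i < m <;> simp [charVector, h]

theorem charVector_injective {m : ℕ} : Function.Injective (charVector (m := m)) := by
  intro S T h
  ext i
  have h₁ := getD_charVector S i
  rw [h, getD_charVector T i] at h₁
  simpa using h₁.symm

theorem map_range_eq_charVector {m : ℕ} {p : ℕ → Bool} {S : Finset (Fin m)}
    (h : ∀ i : Fin m, p i = true ↔ i ∈ S) : (List.range m).map p = charVector S := by
  refine List.ext_getElem (by simp [charVector]) fun i hi _ => ?_
  have hi' : i < m := by simpa using hi
  rw [Bool.eq_iff_iff]
  simpa [charVector] using h ⟨i, hi'⟩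

theorem length_filter_charVector {m : ℕ} (S : Finset (Fin m)) :
    ((charVector S).filter fun b => b).length = S.card := by
  rw [charVector, List.ofFn_eq_map, List.filter_map, List.length_map]
  have h := List.toFinset_card_of_nodup ((List.nodup_finRange m).filter fun j => decide (j ∈ S))
  refine h.symm.trans (congrArg Finset.card ?_)
  ext i
  simp

namespace MulticoloredGraph

variable (I : MulticoloredGraph)

theorem rows_eq : I.rows = List.replicate I.n true :: List.replicate I.k true ::
    (adjacencyRows I.graph ++ List.ofFn fun v => charVector (I.colors v)) := rfl

theorem numVertices_rows : numVertices I.rows = I.n := by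
  simp [numVertices, rows_eq]

theorem numColors_rows : numColors I.rows = I.k := by
  simp [numColors, rows_eq]

theorem bitAt_rows (u v : Fin I.n) : bitAt I.rows (2 + u) v = true ↔ I.graph.Adj u v := by
  simp [bitAt, rows_eq, add_comm 2, adjacencyRows, List.getElem?_append]

theorem colorRow_rows (v : Fin I.n) : colorRow I.rows v = charVector (I.colors v) := by
  have h : 2 + I.n + (v : ℕ) = I.n + v + 1 + 1 := by omega
  rw [colorRow, numVertices_rows, h, rows_eq]
  simp [adjacencyRows]

/-- The vertices that are destroyed by the attack on a number. -/
def Dead (i : ℕ) (v : Fin I.n) : Prop := ∃ h : i < I.k, I.Killed v ⟨i, h⟩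

/-- The first conjunct of `isKilled` forces `i` to be a color. Without it a vertex with no colors
would count as destroyed by any `i` outside the range. -/
theorem isKilled_rows (v : Fin I.n) (i : ℕ) : isKilled I.rows v i = true ↔ I.Dead i v := by
  rw [isKilled, colorRow_rows, numColors_rows, Bool.and_eq_true, getD_charVector, Dead,
    beq_iff_eq]
  constructor
  · rintro ⟨⟨h, hi⟩, heq⟩
    refine ⟨h, charVector_injective (heq.trans (map_range_eq_charVector fun j => ?_))⟩
    simp [Fin.ext_iff]
  · rintro ⟨h, hk⟩
    rw [Killed] at hk
    rw [hk]
    refine ⟨⟨h, by simp⟩, (map_range_eq_charVector fun j => ?_).symm⟩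
    simp [Fin.ext_iff]

theorem isEdge_rows (i : ℕ) (u v : Fin I.n) :
    isEdge I.rows i u v = true ↔ (survivingGraph I.graph (I.Dead i)).Adj u v := by
  simp only [isEdge, survivingGraph, Bool.and_eq_true, bitAt_rows, Bool.not_eq_true',
    ← Bool.not_eq_true, isKilled_rows]

theorem reachSet_rows (i : ℕ) (u v : Fin I.n) :
    (reachSet I.rows i u).getD v false = true ↔
      (survivingGraph I.graph (I.Dead i)).Reachable u v := by
  let step : (Fin I.n → Prop) → Fin I.n → Prop := fun S v =>
    S v ∨ ∃ w, S w ∧ (survivingGraph I.graph (I.Dead i)).Adj w v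
  rw [← mem_iterate_iff_reachable _ u step (fun _ _ => Iff.rfl) v, reachSet, numVertices_rows,
    Fintype.card_fin]
  suffices h : ∀ j (v : Fin I.n), ((expand I.rows i)^[j]
      ((List.range I.n).map fun v => v == (u : ℕ))).getD v false = true ↔
      step^[j] (fun w => w = u) v from h _ v
  intro j
  induction j with
  | zero =>
    intro v
    rw [Function.iterate_zero_apply, Function.iterate_zero_apply, getD_map_range _ _ _ v.2]
    simp [Fin.ext_iff]
  | succ j ih =>
    intro v
    rw [Function.iterate_succ_apply', Function.iterate_succ_apply', expand, numVertices_rows,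
      getD_map_range _ _ _ v.2, Bool.or_eq_true, ih, List.any_eq_true]
    refine or_congr_right ⟨?_, ?_⟩
    · rintro ⟨w, hw, h⟩
      rw [List.mem_range] at hw
      rw [Bool.and_eq_true] at h
      exact ⟨⟨w, hw⟩, (ih ⟨w, hw⟩).1 h.1, (I.isEdge_rows i ⟨w, hw⟩ v).1 h.2⟩
    · rintro ⟨w, hw, h⟩
      refine ⟨w, List.mem_range.2 w.2, ?_⟩
      rw [Bool.and_eq_true]
      exact ⟨(ih w).2 hw, (I.isEdge_rows i w v).2 h⟩

theorem isWeak_rows (u v : Fin I.n) :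
    isWeak I.rows u v = true ↔ WeaklyConnected I.graph I.Killed u v := by
  simp only [isWeak, List.all_eq_true, List.mem_range, numColors_rows, Bool.or_eq_true,
    isKilled_rows, reachSet_rows]
  constructor
  · intro h
    refine ⟨?_, fun i hu hv => ?_⟩
    · have h₁ := h I.k (by omega)
      simp only [Dead, lt_irrefl, IsEmpty.exists_iff, false_or] at h₁
      exact h₁.mono fun _ _ h => And.left h
    · obtain h₁ | h₁ | h₁ := h i (by omega)
      · exact absurd h₁.2 hu
      · exact absurd h₁.2 hv
      · rw [reachable_induce_iff]
        convert! h₁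
        exact ⟨fun h => ⟨_, h⟩, fun h => h.2⟩
  · intro h i hi
    by_cases hu : I.Dead i u
    · exact .inl hu
    by_cases hv : I.Dead i v
    · exact .inr (.inl hv)
    refine .inr (.inr ?_)
    by_cases hik : i < I.k
    · have h₁ := h.2 ⟨i, hik⟩ (fun h => hu ⟨hik, h⟩) (fun h => hv ⟨hik, h⟩)
      rw [reachable_induce_iff] at h₁
      convert! h₁
      exact ⟨fun h => h.2, fun h => ⟨_, h⟩⟩
    · exact h.1.mono fun a b hab => ⟨hab, fun h => hik h.1, fun h => hik h.1⟩

theorem commonSet_rows (u v : Fin I.n) :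
    commonSet I.rows u v = charVector (common I.graph I.Killed u v) := by
  rw [commonSet, numVertices_rows]
  refine map_range_eq_charVector fun w => ?_
  rw [Bool.and_eq_true, isWeak_rows, isWeak_rows, mem_common]

theorem isClique_rows (S : Finset (Fin I.n)) :
    isClique I.rows (charVector S) = true ↔
      ∀ u ∈ S, ∀ v ∈ S, WeaklyConnected I.graph I.Killed u v := by
  have h (u : Fin I.n) : (charVector S).getD u false = true ↔ u ∈ S := by
    rw [getD_charVector]
    simp
  simp only [isClique, List.all_eq_true, List.mem_range, numVertices_rows, Bool.or_eq_true,
    Bool.not_eq_true', ← Bool.not_eq_true, ← imp_iff_not_or]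
  constructor
  · exact fun h' u hu v hv =>
      (I.isWeak_rows u v).1 (h' u u.2 ((h u).2 hu) v v.2 ((h v).2 hv))
  · exact fun h' u hu hu' v hv hv' =>
      (I.isWeak_rows ⟨u, hu⟩ ⟨v, hv⟩).2 (h' _ ((h ⟨u, hu⟩).1 hu') _ ((h ⟨v, hv⟩).1 hv'))

theorem killed_unique (v : Fin I.n) (i j : Fin I.k) (hi : I.Killed v i) (hj : I.Killed v j) :
    i = j :=
  Finset.singleton_injective (hi.symm.trans hj)

/-- The graph without vertices is exceptional: there is no pair to try, yet the empty set is a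
component, with the empty vector. -/
theorem mem_components_rows (S : List Bool) :
    S ∈ components I.rows ↔ ∃ T, I.IsComponent T ∧ charVector T = S := by
  rw [components, numVertices_rows]
  rcases Nat.eq_zero_or_pos I.n with hn | hn
  · have : IsEmpty (Fin I.n) := by rw [hn]; infer_instance
    have h (T : Finset (Fin I.n)) : charVector T = [] :=
      List.eq_nil_of_length_eq_zero (by simp [charVector, hn])
    simp only [hn, List.range_zero, List.isEmpty_nil, cond_true, List.mem_singleton, h,
      exists_and_right]
    exact ⟨fun h => ⟨⟨∅, isWeakComponent_of_isEmpty _⟩, h.symm⟩, fun h => h.2.symm⟩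
  · have : Nonempty (Fin I.n) := ⟨⟨0, hn⟩⟩
    have hr : (List.range I.n).isEmpty = false := by simpa using hn.ne'
    simp only [hr, cond_false, List.mem_flatMap, List.mem_range, IsComponent,
      isWeakComponent_iff I.killed_unique]
    constructor
    · rintro ⟨u, hu, v, hv, h⟩
      have hw := I.isWeak_rows ⟨u, hu⟩ ⟨v, hv⟩
      have hc := I.commonSet_rows ⟨u, hu⟩ ⟨v, hv⟩
      simp only at hw hc
      rw [Bool.cond_eq_ite] at h
      split_ifs at h with h'
      · rw [Bool.and_eq_true, hw, hc, isClique_rows] at h'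
        rw [List.mem_singleton, hc] at h
        exact ⟨_, ⟨_, _, h'.1, rfl, h'.2⟩, h.symm⟩
      · simp at h
    · rintro ⟨T, ⟨u, v, huv, rfl, hcl⟩, rfl⟩
      refine ⟨u, u.2, v, v.2, ?_⟩
      rw [(I.isWeak_rows u v).2 huv, I.commonSet_rows, (I.isClique_rows _).2 hcl]
      simp

end MulticoloredGraph

/-! ### Repetitions, and sets recovered from their vectors. -/

theorem removeDup_aux (L acc : List (List Bool)) (hacc : acc.Nodup) :
    (L.foldl (fun acc S => bif acc.any fun T => S == T then acc else S :: acc) acc).Nodup ∧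
    ∀ S, S ∈ L.foldl (fun acc S => bif acc.any fun T => S == T then acc else S :: acc) acc ↔
      S ∈ L ∨ S ∈ acc := by
  induction L generalizing acc with
  | nil => simpa using hacc
  | cons S L ih =>
    rw [List.foldl_cons, Bool.cond_eq_ite]
    split_ifs with h
    · have hS : S ∈ acc := by simpa using h
      refine ⟨(ih acc hacc).1, fun T => ?_⟩
      rw [(ih acc hacc).2, List.mem_cons]
      constructor
      · tauto
      · rintro ((rfl | h) | h) <;> tauto
    · have hS : S ∉ acc := by simpa using h
      have := ih (S :: acc) (List.nodup_cons.2 ⟨hS, hacc⟩)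
      refine ⟨this.1, fun T => ?_⟩
      rw [this.2, List.mem_cons, List.mem_cons]
      tauto

theorem nodup_removeDup (L : List (List Bool)) : (removeDup L).Nodup :=
  (removeDup_aux L [] List.nodup_nil).1

theorem mem_removeDup (L : List (List Bool)) (S : List Bool) : S ∈ removeDup L ↔ S ∈ L := by
  rw [removeDup, (removeDup_aux L [] List.nodup_nil).2]
  simp

/-- The set with a given characteristic vector. -/
def ofVector (m : ℕ) (S : List Bool) : Finset (Fin m) := {j | S.getD j false = true}

theorem ofVector_charVector {m : ℕ} (S : Finset (Fin m)) : ofVector m (charVector S) = S := by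
  ext i
  rw [ofVector, Finset.mem_filter, getD_charVector]
  simp

end ColorAvoiding

namespace ColorAvoiding

/-! ### Correctness of the parser -/

theorem encodeLists_cons (r : List Bool) (L : List (List Bool)) :
    encodeLists (r :: L) = r.map some ++ none :: encodeLists L := by
  simp [encodeLists]

theorem parse_reverse (w : List Symbol) :
    parse w.reverse = w.foldr (fun a acc => parseStep acc a) [] := by
  rw [parse, List.foldl_reverse]

theorem foldr_parseStep_some (r s : List Bool) (L : List (List Bool)) :
    (r.map some).foldr (fun a acc => parseStep acc a) (s :: L) = (r ++ s) :: L := by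
  induction r with
  | nil => rfl
  | cons b r ih =>
    rw [List.map_cons, List.foldr_cons, ih]
    simp [parseStep]

theorem parse_encodeLists (L : List (List Bool)) : parse (encodeLists L).reverse = L := by
  rw [parse_reverse]
  induction L with
  | nil => rfl
  | cons r L ih =>
    rw [encodeLists_cons, List.foldr_append, List.foldr_cons, ih]
    exact (foldr_parseStep_some r [] L).trans (by rw [List.append_nil])

/-- Once a separator has been read from the right, the parser discards nothing, so the word can be
recovered. -/
theorem encodeLists_foldr_parseStep (w : List Symbol) (r : List Bool) (L : List (List Bool)) :
    ∃ r' L', w.foldr (fun a acc => parseStep acc a) (r :: L) = r' :: L' ∧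
      encodeLists (r' :: L') = w ++ encodeLists (r :: L) := by
  induction w with
  | nil => exact ⟨r, L, rfl, rfl⟩
  | cons a w ih =>
    obtain ⟨r', L', h, h'⟩ := ih
    rw [List.foldr_cons, h, List.cons_append, ← h']
    rcases a with _ | b
    · exact ⟨[], r' :: L', by simp [parseStep], by simp [encodeLists_cons]⟩
    · exact ⟨b :: r', L', by simp [parseStep], by simp [encodeLists_cons]⟩

/-- The parser drops bits after the last separator, hence the condition that the word ends with one.
The default `some true` rules out the empty word. -/
theorem encodeLists_parse {w : List Symbol} (h : (w.reverse.headD (some true)).isNone = true) :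
    encodeLists (parse w.reverse) = w := by
  rw [parse_reverse]
  induction w using List.reverseRecOn with
  | nil => simp at h
  | append_singleton w a _ =>
    have ha : a = none := by simpa using h
    subst ha
    obtain ⟨r, L, h, h'⟩ := encodeLists_foldr_parseStep w [] []
    rw [List.foldr_append]
    refine Eq.trans (congrArg encodeLists h) h'

theorem headD_reverse_encodeLists (r : List Bool) (L : List (List Bool)) :
    ((encodeLists (r :: L)).reverse.headD (some true)).isNone = true := by
  induction L generalizing r with
  | nil => simp [encodeLists]
  | cons r' L ih =>
    rw [encodeLists_cons, List.append_cons, List.reverse_append, List.headD_eq_head?_getD,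
      List.head?_append]
    have h := ih r'
    rw [List.headD_eq_head?_getD] at h
    cases h' : (encodeLists (r' :: L)).reverse.head? <;> simp_all

/-! ### Binary numbers -/

theorem foldl_incStep_false (l out : List Bool) :
    l.foldl incStep (false, out) = (false, l.reverse ++ out) := by
  induction l generalizing out with
  | nil => rfl
  | cons b l ih => simp [incStep, ih]

/-- Bits already written do not influence the carry. -/
theorem foldl_incStep_append (l out : List Bool) (c : Bool) :
    l.foldl incStep (c, out) =
      ((l.foldl incStep (c, [])).1, (l.foldl incStep (c, [])).2 ++ out) := by
  induction l generalizing c out with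
  | nil => rfl
  | cons b l ih =>
    rw [List.foldl_cons, List.foldl_cons, incStep, incStep, ih, ih [_]]
    simp

theorem incBits_false (l : List Bool) : incBits (false :: l) = true :: l := by
  simp [incBits, incResult, incStep, foldl_incStep_false]

theorem incBits_true (l : List Bool) : incBits (true :: l) = false :: incBits l := by
  have h : incBits (true :: l) = incResult (l.foldl incStep (true, [false])) := rfl
  rw [h, foldl_incStep_append, incBits, incResult, incResult]
  cases (l.foldl incStep (true, [])).1 <;> simp

/-- The least significant bit comes first, so incrementing an even number changes only the head, and
an odd one passes the carry on to its half. -/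
theorem incBits_bits (n : ℕ) : incBits n.bits = (n + 1).bits := by
  induction n using Nat.binaryRec' with
  | zero => simp [incBits, incResult]
  | bit b n hn ih =>
    rw [Nat.bits_append_bit n b hn]
    cases b with
    | false =>
      rw [incBits_false, show Nat.bit false n + 1 = Nat.bit true n by simp [Nat.bit_val],
        Nat.bits_append_bit n true fun _ => rfl]
    | true =>
      rw [incBits_true, ih, show Nat.bit true n + 1 = Nat.bit false (n + 1) by
        simp [Nat.bit_val]; omega, Nat.bits_append_bit (n + 1) false fun h => by omega]

theorem incBits_iterate (n : ℕ) : incBits^[n] [] = n.bits := by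
  induction n with
  | zero => simp
  | succ n ih => rw [Function.iterate_succ_apply', ih, incBits_bits]

/-! ### Correctness of the validity check -/

theorem map_range_eq_ofFn {α : Type*} {m : ℕ} {f : ℕ → α} {g : Fin m → α}
    (h : ∀ i : Fin m, f i = g i) : (List.range m).map f = List.ofFn g := by
  refine List.ext_getElem (by simp) fun i hi _ => ?_
  have hi' : i < m := by simpa using hi
  simpa using h ⟨i, hi'⟩

-- Used twice in `isValid_iff`: for a graph defined by reading off `R`, and for `R` equal to the
-- rows of a given graph.
open Classical in
theorem MulticoloredGraph.rows_eq_canonicalRows (I : MulticoloredGraph) {R : List (List Bool)}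
    (hn : numVertices R = I.n) (hk : numColors R = I.k)
    (hadj : ∀ u v : Fin I.n, bitAt R (2 + u) v = true ↔ I.graph.Adj u v)
    (hcol : ∀ (v : Fin I.n) (i : Fin I.k), (colorRow R v).getD i false = true ↔ i ∈ I.colors v) :
    I.rows = canonicalRows R := by
  rw [MulticoloredGraph.rows, canonicalRows, hn, hk]
  congr 1
  · congr 1
    refine (map_range_eq_ofFn fun u => map_range_eq_ofFn fun v => ?_).symm
    rw [Bool.eq_iff_iff, hadj, decide_eq_true_iff]
  · exact (map_range_eq_ofFn fun v => map_range_eq_charVector fun i => hcol v i).symm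

/-- Reading the entries of `R` gives a graph as soon as the adjacency bits are symmetric and
loopless; equality with `canonicalRows R` ensures that nothing else is in `R`. -/
theorem isValid_iff (R : List (List Bool)) :
    isValid R = true ↔ ∃ I : MulticoloredGraph, I.rows = R := by
  simp only [isValid, Bool.and_eq_true, beq_iff_eq, List.all_eq_true, List.mem_range,
    Bool.not_eq_true']
  constructor
  · rintro ⟨h, h'⟩
    let I : MulticoloredGraph :=
      { n := numVertices R
        k := numColors R
        graph :=
          { Adj := fun u v => bitAt R (2 + u) v = true
            symm := ⟨fun u v huv => ((h' u u.2).2 v v.2).symm.trans huv⟩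
            loopless := ⟨fun u hu => by simp [(h' u u.2).1] at hu⟩ }
        colors := fun v => {i | (colorRow R v).getD i false = true} }
    refine ⟨I, (I.rows_eq_canonicalRows rfl rfl (fun _ _ => Iff.rfl) fun v i => ?_).trans h.symm⟩
    simp [I]
  · rintro ⟨I, rfl⟩
    refine ⟨I.rows_eq_canonicalRows I.numVertices_rows I.numColors_rows I.bitAt_rows fun v i => ?_,
      fun u hu => ⟨?_, fun v hv => ?_⟩⟩
    · rw [I.colorRow_rows, getD_charVector]
      simp
    · rw [I.numVertices_rows] at hu
      rw [← Bool.not_eq_true, I.bitAt_rows ⟨u, hu⟩ ⟨u, hu⟩]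
      exact I.graph.loopless.irrefl _
    · rw [I.numVertices_rows] at hu hv
      rw [Bool.eq_iff_iff, I.bitAt_rows ⟨u, hu⟩ ⟨v, hv⟩, I.bitAt_rows ⟨v, hv⟩ ⟨u, hu⟩]
      exact I.graph.adj_comm _ _

/-! ### Colored graphs as multicolored graphs with singletons. -/

/-- A colored graph as a multicolored graph. -/
def ColoredGraph.toMulti (J : ColoredGraph) : MulticoloredGraph :=
  ⟨J.n, J.k, J.graph, fun v => {J.color v}⟩

theorem ColoredGraph.isComponent_toMulti (J : ColoredGraph) (S : Finset (Fin J.n)) :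
    J.toMulti.IsComponent S ↔ J.IsComponent S := by
  have h : J.toMulti.Killed = J.Killed := by
    funext v i
    exact propext Finset.singleton_inj
  change IsWeakComponent J.graph J.toMulti.Killed S ↔ _
  rw [h]
  rfl

theorem isSingle_rows (I : MulticoloredGraph) :
    isSingle I.rows = true ↔ ∃ J : ColoredGraph, J.toMulti = I := by
  simp only [isSingle, List.all_eq_true, List.any_eq_true, List.mem_range, I.numVertices_rows,
    I.numColors_rows]
  constructor
  · intro h
    have h' : ∀ v : Fin I.n, ∃ i : Fin I.k, I.Killed v i := fun v => by
      obtain ⟨i, -, hi⟩ := h v v.2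
      obtain ⟨hik, hi⟩ := (I.isKilled_rows v i).1 hi
      exact ⟨_, hi⟩
    choose c hc using h'
    refine ⟨⟨I.n, I.k, I.graph, c⟩, ?_⟩
    have : (fun v => {c v}) = I.colors := funext fun v => (hc v).symm
    rw [ColoredGraph.toMulti]
    simp only [this]
  · rintro ⟨J, rfl⟩ v hv
    exact ⟨J.color ⟨v, hv⟩, (J.color ⟨v, hv⟩).2,
      (J.toMulti.isKilled_rows ⟨v, hv⟩ _).2 ⟨(J.color ⟨v, hv⟩).2, rfl⟩⟩

/-! ### The decision problems and the enumeration -/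

/-- A binary number may be exponentially large, so it is not converted to unary. It is compared with
the binary forms of the numbers from `1` to the size of a component, which also rejects words that
are not canonical. -/
theorem isLarge_rows (I : MulticoloredGraph) (b : List Bool) :
    isLarge b I.rows = true ↔
      ∃ l, 0 < l ∧ l.bits = b ∧ ∃ S, I.IsComponent S ∧ l ≤ S.card := by
  simp only [isLarge, List.any_eq_true, I.mem_components_rows, List.mem_range, beq_iff_eq,
    incBits_iterate]
  constructor
  · rintro ⟨_, ⟨S, hS, rfl⟩, j, hj, rfl⟩
    rw [length_filter_charVector] at hj
    exact ⟨j + 1, by omega, rfl, S, hS, hj⟩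
  · rintro ⟨l, hl, rfl, S, hS, hlS⟩
    refine ⟨_, ⟨S, hS, rfl⟩, l - 1, ?_, ?_⟩
    · rw [length_filter_charVector]
      omega
    · rw [Nat.sub_add_cancel hl]

theorem decideMulti_iff (w : List Symbol) : decideMulti w.reverse = true ↔
    ∃ (I : MulticoloredGraph) (l : ℕ), 0 < l ∧ w = I.encodeWith l ∧
      ∃ S, I.IsComponent S ∧ l ≤ S.card := by
  simp only [decideMulti, Bool.and_eq_true, isValid_iff]
  constructor
  · rintro ⟨hw, ⟨I, hI⟩, hl⟩
    rw [← hI, isLarge_rows] at hl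
    obtain ⟨l, hl, hb, h⟩ := hl
    refine ⟨I, l, hl, ?_, h⟩
    rw [MulticoloredGraph.encodeWith, hb, hI]
    refine (encodeLists_parse hw).symm.trans (congrArg encodeLists ?_)
    -- The parsed list has a head, because its tail is the nonempty list of rows of `I`.
    cases hp : parse w.reverse with
    | nil => simp [hp, I.rows_eq] at hI
    | cons r L => simp
  · rintro ⟨I, l, hl, rfl, h⟩
    refine ⟨headD_reverse_encodeLists _ _, ?_⟩
    rw [MulticoloredGraph.encodeWith, parse_encodeLists]
    exact ⟨⟨I, rfl⟩, (isLarge_rows I _).2 ⟨l, hl, rfl, h⟩⟩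

theorem decideSingle_iff (w : List Symbol) : decideSingle w.reverse = true ↔
    ∃ (I : ColoredGraph) (l : ℕ), 0 < l ∧ w = I.encodeWith l ∧
      ∃ S, I.IsComponent S ∧ l ≤ S.card := by
  rw [decideSingle, Bool.and_eq_true, decideMulti_iff]
  constructor
  · rintro ⟨⟨I, l, hl, rfl, S, hS, h⟩, hs⟩
    rw [MulticoloredGraph.encodeWith, parse_encodeLists] at hs
    obtain ⟨J, rfl⟩ := (isSingle_rows I).1 hs
    exact ⟨J, l, hl, rfl, S, (J.isComponent_toMulti S).1 hS, h⟩
  · rintro ⟨J, l, hl, rfl, S, hS, h⟩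
    refine ⟨⟨J.toMulti, l, hl, rfl, S, (J.isComponent_toMulti S).2 hS, h⟩, ?_⟩
    rw [ColoredGraph.encodeWith, parse_encodeLists]
    exact (isSingle_rows J.toMulti).2 ⟨J, rfl⟩

open Classical in
theorem inP_of_decide {L : Language Symbol} {F : List Symbol → Bool} (hF : PT F)
    (h : ∀ w, F w.reverse = true ↔ w ∈ L) : InP L := by
  refine hF.nonempty_computable_bool fun w => ?_
  rw [Bool.eq_iff_iff, h, decide_eq_true_iff]

theorem listComponents_encodeLists (L : List (List Bool)) :
    listComponents (encodeLists L).reverse = (encodeLists (removeDup (components L))).reverse := by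
  rw [listComponents, parse_encodeLists, encodeLists]

/-- The list of the components. -/
noncomputable def MulticoloredGraph.componentList (I : MulticoloredGraph) : List (Finset (Fin I.n)) :=
  (removeDup (components I.rows)).map (ofVector I.n)

theorem MulticoloredGraph.map_charVector_componentList (I : MulticoloredGraph) :
    I.componentList.map charVector = removeDup (components I.rows) := by
  rw [componentList, List.map_map]
  refine (List.map_congr_left fun S hS => ?_).trans (List.map_id _)
  obtain ⟨T, -, rfl⟩ := (I.mem_components_rows S).1 ((mem_removeDup _ S).1 hS)
  exact congrArg charVector (ofVector_charVector T)

theorem MulticoloredGraph.nodup_componentList (I : MulticoloredGraph) : I.componentList.Nodup := by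
  refine List.Nodup.of_map charVector ?_
  rw [map_charVector_componentList]
  exact nodup_removeDup _

theorem MulticoloredGraph.mem_componentList (I : MulticoloredGraph) (S : Finset (Fin I.n)) :
    S ∈ I.componentList ↔ I.IsComponent S := by
  rw [← List.mem_map_of_injective charVector_injective, map_charVector_componentList,
    mem_removeDup, mem_components_rows]
  exact ⟨fun ⟨T, hT, h⟩ => charVector_injective h ▸ hT, fun h => ⟨S, h, rfl⟩⟩

end ColorAvoiding

theorem corollary1 :
    (ColorAvoiding.InP ColorAvoiding.weaklyColorAvoidingConnectedComponent ∧
      ColorAvoiding.FindableInPolyTime ColorAvoiding.ColoredGraph.encode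
        ColorAvoiding.ColoredGraph.n (fun I => {S | I.IsComponent S})) ∧
    (ColorAvoiding.InP ColorAvoiding.weaklyColorAvoidingConnectedComponentMulti ∧
      ColorAvoiding.FindableInPolyTime ColorAvoiding.MulticoloredGraph.encode
        ColorAvoiding.MulticoloredGraph.n (fun I => {S | I.IsComponent S})) := by
  open ColorAvoiding in
  refine ⟨⟨inP_of_decide .decideSingle decideSingle_iff,
    fun J => J.toMulti.componentList, fun J => ⟨J.toMulti.nodup_componentList, fun S => ?_⟩, ?_⟩,
    inP_of_decide .decideMulti decideMulti_iff,
    fun I => I.componentList, fun I => ⟨I.nodup_componentList, I.mem_componentList⟩, ?_⟩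
  · exact (J.toMulti.mem_componentList S).trans (J.isComponent_toMulti S)
  · refine PT.listComponents.nonempty_computable_word fun J => ?_
    rw [ColoredGraph.encode, listComponents_encodeLists]
    -- The rows of `J` and of `J.toMulti` agree by definition.
    exact congrArg (fun L => (encodeLists L).reverse) J.toMulti.map_charVector_componentList.symm
  · refine PT.listComponents.nonempty_computable_word fun I => ?_
    rw [MulticoloredGraph.encode, listComponents_encodeLists, I.map_charVector_componentList]
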